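/- Let $n\ge 0$ and let $\mathfrak G=\mathfrak{gl}(n)[\lambda,\lambda^{-1}]$ be the associative algebra of Laurent polynomials $L_\lambda=\sum_k L_k\lambda^k$ with real $n\times n$ matrix coefficients. It is the Kupershmidt algebra of shift operators on $n$-periodic sequences: for $\sigma=(\sigma|_1,\dots,\sigma|_n)$, the operator $\sigma\Delta^k$ is the matrix with entry $\sigma|_i\lambda^m$ at each position $(i,j)$ with $j-i+nm=k$, and $0$ elsewhere. Put $$[A,B]=AB-BA,\qquad A\bullet B=\tfrac12(AB+BA),\qquad *(L_\lambda)=(L_{\lambda^{-1}})^t,\qquad (L_\lambda,M_\lambda)=\mathrm{tr}\big((L_\lambda M_\lambda)_0\big),$$ where $(\cdot)_0$ is the coefficient of $\lambda^0$. Let $\mathfrak G_+=\{L:*L=-L\}$, $\mathfrak G^+=\{L:*L=L\}$, let $\mathfrak G_k$ be the subspace of elements with powers of $\Delta$ not greater than $k$, and let $\mathfrak G_-=\mathfrak G_0$. Then $\mathfrak G=\mathfrak G_+\oplus\mathfrak G_-$, with projections $\Pi_\pm$; put $R=\frac12(\Pi_+-\Pi_-)$. For $L,A,B\in\mathfrak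 G$ set $$P_{Sem}(L)(A,B)=(L,[RA,B]+[A,RB]),\qquad P_{Skl}(L)(A,B)=(L,[R(L\bullet A),B]+[A,R(L\bullet B)]).$$ The elements of $\mathfrak G^+_{n-1}=\mathfrak G^+\cap\mathfrak G_{n-1}$ are exactly the $L_\lambda=L_0+L_1\lambda+L_1^t\lambda^{-1}$ with $L_0$ symmetric and $L_1$ strictly lower triangular, and $\Phi(L_\lambda)=L_0+L_1-L_1^t$ defines a linear isomorphism $\Phi:\mathfrak G^+_{n-1}\to\mathfrak{gl}(n)$. For $L,M\in\mathfrak{gl}(n)$ let $L_S=\frac12(L+L^t)$, $L_A=\frac12(L-L^t)$, $((L,M))=\mathrm{tr}(LM^t)$, $$[[L,M]]=[L_S,M_S]-[L_A,M_A]-[L_S,M_A]-[L_A,M_S],$$ $$L\odot M=L_S\bullet M_S-L_A\bullet M_A+L_A\bullet M_S+L_S\bullet M_A,$$ and let $\rho(L)$ be the strictly upper triangular part of $L$ minus its strictly lower triangular part. Let $\nabla$ be the gradient on $\mathfrak{gl}(n)$ with respect to $((\cdot,\cdot))$. For smooth $f,g:\mathfrak{gl}(n)\to\mathbb R$ put $$\{f,g\}_{Lin}(L)=((L,[[\nabla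 f(L),\nabla g(L)]])),$$ $$\{f,g\}_{a}(L)=P_{a}\big(\Phi^{-1}L\big)\big(\Phi^{-1}\nabla f(L),\Phi^{-1}\nabla g(L)\big),\qquad a\in\{Sem,Skl\}.$$ Theorem. (1) $\{\cdot,\cdot\}_{Sem}$ and $\{\cdot,\cdot\}_{Skl}$ are the brackets obtained by restricting $P_{Sem}$ and $P_{Skl}$ to $\mathfrak G^+_{n-1}$ and transporting them by $\Phi$: for $a\in\{Sem,Skl\}$, smooth $f,g$ on $\mathfrak{gl}(n)$, $L_\lambda\in\mathfrak G^+_{n-1}$, and all $A,B\in\mathfrak G$ such that $(A,M)=df_{\Phi(L_\lambda)}(\Phi M)$ and $(B,M)=dg_{\Phi(L_\lambda)}(\Phi M)$ for every $M\in\mathfrak G^+_{n-1}$, one has $\{f,g\}_a(\Phi(L_\lambda))=P_a(L_\lambda)(A,B)$. (2) The three brackets $\{\cdot,\cdot\}_{Sem}$, $\{\cdot,\cdot\}_{Lin}$ and $\{\cdot,\cdot\}_{Skl}$ are mutually compatible Poisson brackets on $C^\infty(\mathfrak{gl}(n))$, hence a trihamiltonian structure. That is, each of them is a Poisson bracket,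 and for any two of them, $\{\cdot,\cdot\}$ and $\{\cdot,\cdot\}'$, the bracket $\{\cdot,\cdot\}'-c\{\cdot,\cdot\}$ is a Poisson bracket for every $c\in\mathbb R$. (3) $\{\cdot,\cdot\}_{Sem}$ and $\{\cdot,\cdot\}_{Skl}$ are the brackets of the Lie derivatives of the tensor of $\{\cdot,\cdot\}_{Lin}$ along the vector fields $X(L)=\rho(L_A)$ and $Y(L)=L\odot\rho(L_A)$ respectively: for all smooth $f,g$, $$\{f,g\}_{Sem}=X(\{f,g\}_{Lin})-\{X(f),g\}_{Lin}-\{f,X(g)\}_{Lin},$$ $$\{f,g\}_{Skl}=Y(\{f,g\}_{Lin})-\{Y(f),g\}_{Lin}-\{f,Y(g)\}_{Lin}.$$ -/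

import Mathlib

open scoped LaurentPolynomial ContDiff

attribute [local instance] Matrix.normedAddCommGroup Matrix.normedSpace

noncomputable section

namespace Kupershmidt

/-- `gl(n)`: real `n × n` matrices. As a manifold it is a finite dimensional real vector space, and
smoothness does not depend on the choice of the norm. -/
abbrev Gl (n : ℕ) : Type := Matrix (Fin n) (Fin n) ℝ

/-- The Kupershmidt algebra of shift operators on `n`-periodic sequences, in its loop algebra form:
Laurent polynomials in `λ` with coefficients in `gl(n)`, that is, matrices of Laurent polynomials.
For a sequence `σ` the operator `σ Δ ^ k` is the matrix with the entry `σ i * λ ^ m` at each position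
`(i, j)` such that `j - i + n * m = k`, and `0` elsewhere. -/
abbrev Loop (n : ℕ) : Type := Matrix (Fin n) (Fin n) ℝ[T;T⁻¹]

variable {n : ℕ}

/-! ### The loop algebra -/

/-- The coefficient of `λ ^ m` of a loop. -/
def loopCoeff (m : ℤ) : Loop n →ₗ[ℝ] Gl n where
  toFun L := Matrix.of fun i j => (L i j).coeff m
  map_add' L M := by ext i j; simp
  map_smul' c L := by ext i j; simp

/-- The involution: the transpose of `L` with `λ` replaced by its inverse. It exchanges `σ Δ ^ k`
and `Δ ^ (-k) σ`. -/
def involution : Loop n →ₗ[ℝ] Loop n where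
  toFun L := Matrix.of fun i j => LaurentPolynomial.invert (L j i)
  map_add' L M := by ext i j; simp
  map_smul' c L := by ext i j; simp

/-- The invariant scalar product `Tr (L M)`, where `Tr` is the trace of the coefficient of
`λ ^ 0`. -/
def loopInner (L M : Loop n) : ℝ := Matrix.trace (loopCoeff 0 (L * M))

/-- The subspace of the elements with powers of `Δ` not greater than `k`. The position `(i, j)` of
the coefficient of `λ ^ m` belongs to the power `j - i + n * m` of `Δ`. -/
def degLE (n : ℕ) (k : ℤ) : Submodule ℝ (Loop n) where
  carrier := {L | ∀ (i j : Fin n) (m : ℤ), k < (j : ℤ) - i + n * m → (L i j).coeff m = 0}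
  zero_mem' := by intro i j m _; simp
  add_mem' := by intro L M hL hM i j m h; simp [hL i j m h, hM i j m h]
  smul_mem' := by intro c L hL i j m h; simp [hL i j m h]

/-- The subalgebra `𝔊₊` of skewsymmetric elements. -/
def skewElts (n : ℕ) : Submodule ℝ (Loop n) where
  carrier := {L | involution L = -L}
  zero_mem' := by simp
  add_mem' := by intro L M hL hM; simp only [Set.mem_ofPred_eq] at *; rw [map_add, hL, hM]; abel
  smul_mem' := by intro c L hL; simp only [Set.mem_ofPred_eq] at *; rw [map_smul, hL, smul_neg]

/-- The subspace `𝔊⁺` of symmetric elements. -/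
def symmElts (n : ℕ) : Submodule ℝ (Loop n) where
  carrier := {L | involution L = L}
  zero_mem' := by simp
  add_mem' := by intro L M hL hM; simp only [Set.mem_ofPred_eq] at *; rw [map_add, hL, hM]
  smul_mem' := by intro c L hL; simp only [Set.mem_ofPred_eq] at *; rw [map_smul, hL]

theorem involution_coeff (L : Loop n) (i j : Fin n) (m : ℤ) :
    (involution L i j).coeff m = (L j i).coeff (-m) := by
  simp [involution]

theorem mem_skewElts_iff (L : Loop n) :
    L ∈ skewElts n ↔ ∀ i j m, (L j i).coeff (-m) = -(L i j).coeff m := by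
  constructor
  · intro h i j m
    have h' : involution L = -L := h
    rw [← involution_coeff, h']
    simp
  · intro h
    change involution L = -L
    ext i j m
    rw [involution_coeff, h]
    simp

theorem mem_symmElts_iff (L : Loop n) :
    L ∈ symmElts n ↔ ∀ i j m, (L j i).coeff (-m) = (L i j).coeff m := by
  constructor
  · intro h i j m
    have h' : involution L = L := h
    rw [← involution_coeff, h']
  · intro h
    change involution L = L
    ext i j m
    rw [involution_coeff, h]

/-- The part of a loop with positive powers of `Δ`. -/
def positivePart (L : Loop n) : Loop n :=
  Matrix.of fun i j =>
    AddMonoidAlgebra.ofCoeff ((L i j).coeff.filter fun m => 0 < (j : ℤ) - i + n * m)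

open Classical in
theorem positivePart_coeff (L : Loop n) (i j : Fin n) (m : ℤ) :
    (positivePart L i j).coeff m = if 0 < (j : ℤ) - i + n * m then (L i j).coeff m else 0 := by
  simp [positivePart, Finsupp.filter_apply]

/-- The decomposition `𝔊 = 𝔊₊ ⊕ 𝔊₋`, where `𝔊₋` is the subalgebra of elements of degree at most
`0`. -/
theorem isCompl_skewElts_degLE : IsCompl (skewElts n) (degLE n 0) := by
  constructor
  · rw [Submodule.disjoint_def]
    intro L hL hL'
    rw [mem_skewElts_iff] at hL
    ext i j m
    rcases lt_trichotomy 0 ((j : ℤ) - i + n * m) with h | h | h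
    · simpa using hL' i j m h
    · have hi : (i : ℤ) < n := by exact_mod_cast i.2
      have hj : (j : ℤ) < n := by exact_mod_cast j.2
      have hi0 : (0 : ℤ) ≤ i := by positivity
      have hj0 : (0 : ℤ) ≤ j := by positivity
      have hm : m = 0 := by
        by_contra hm
        rcases lt_or_gt_of_ne hm with hm | hm <;> nlinarith
      subst hm
      have hij : i = j := by
        apply Fin.ext
        have : (j : ℤ) - i = 0 := by linarith
        omega
      subst hij
      have := hL i i 0
      simp only [neg_zero] at this
      have : (L i i).coeff 0 = 0 := by linarith
      simpa using this
    · have h1 := hL' j i (-m) (by linarith)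
      have h2 := hL i j m
      have : (L i j).coeff m = 0 := by linarith
      simpa using this
  · rw [Submodule.codisjoint_iff_exists_add_eq]
    intro L
    refine ⟨positivePart L - involution (positivePart L),
      L - (positivePart L - involution (positivePart L)), ?_, ?_, by abel⟩
    · rw [mem_skewElts_iff]
      intro i j m
      simp [involution_coeff]
    · intro i j m h
      simp only [Matrix.sub_apply, AddMonoidAlgebra.coeff_sub, Finsupp.sub_apply,
        involution_coeff, positivePart_coeff]
      rw [if_pos h, if_neg (by linarith)]
      simp

/-- The linear map `R = (Π₊ - Π₋) / 2`, where `Π₊` and `Π₋` are the projections of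
`𝔊 = 𝔊₊ ⊕ 𝔊₋`. -/
def rMatrix (n : ℕ) : Loop n →ₗ[ℝ] Loop n :=
  (1 / 2 : ℝ) •
    (Submodule.projection (skewElts n) (degLE n 0) isCompl_skewElts_degLE -
      Submodule.projection (degLE n 0) (skewElts n) isCompl_skewElts_degLE.symm)

/-- The commutative product `A • B = (A B + B A) / 2` of an associative algebra. -/
def jordan {𝔸 : Type*} [Ring 𝔸] [Algebra ℝ 𝔸] (A B : 𝔸) : 𝔸 := (1 / 2 : ℝ) • (A * B + B * A)

/-- The Semenov-Tian-Shansky tensor of the loop algebra at the point `L`, evaluated on two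
gradients `A` and `B`. -/
def loopSem (L A B : Loop n) : ℝ :=
  loopInner L (⁅rMatrix n A, B⁆ + ⁅A, rMatrix n B⁆)

/-- The Sklyanin tensor of the loop algebra at the point `L`, evaluated on two gradients `A` and
`B`. -/
def loopSkl (L A B : Loop n) : ℝ :=
  loopInner L (⁅rMatrix n (jordan L A), B⁆ + ⁅A, rMatrix n (jordan L B)⁆)

/-! ### Structures on `gl(n)` -/

/-- The symmetric part of a matrix. -/
def symPart (L : Gl n) : Gl n := (1 / 2 : ℝ) • (L + L.transpose)

/-- The skewsymmetric part of a matrix. -/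
def altPart (L : Gl n) : Gl n := (1 / 2 : ℝ) • (L - L.transpose)

/-- The scalar product `((L, M)) = tr (L Mᵗ)`. -/
def glInner (L M : Gl n) : ℝ := Matrix.trace (L * M.transpose)

/-- The non-standard Lie bracket `[[L, M]]`. -/
def nsBracket (L M : Gl n) : Gl n :=
  ⁅symPart L, symPart M⁆ - ⁅altPart L, altPart M⁆ - ⁅symPart L, altPart M⁆ - ⁅altPart L, symPart M⁆

/-- The commutative product `L ⊙ M`. -/
def odot (L M : Gl n) : Gl n :=
  jordan (symPart L) (symPart M) - jordan (altPart L) (altPart M) + jordan (altPart L) (symPart M)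
    + jordan (symPart L) (altPart M)

/-- `ρ L` is the strictly upper triangular part of `L` minus the strictly lower triangular one. -/
def rho (L : Gl n) : Gl n :=
  Matrix.of fun i j => if i < j then L i j else if j < i then -L i j else 0

/-! ### The isomorphism `Φ` -/

/-- The subspace `𝔊⁺ₙ₋₁` of symmetric elements with powers of `Δ` not greater than `n - 1`. -/
def phaseSpace (n : ℕ) : Submodule ℝ (Loop n) := symmElts n ⊓ degLE n ((n : ℤ) - 1)

/-- The strictly lower triangular part of a matrix. -/
def lowerPart (L : Gl n) : Gl n := Matrix.of fun i j => if j < i then L i j else 0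

/-- The loop `L_S + λ (L_A)_low + λ⁻¹ ((L_A)_low)ᵗ`, where `low` is the strictly lower triangular
part. -/
def toLoop (L : Gl n) : Loop n :=
  Matrix.of fun i j =>
    AddMonoidAlgebra.single 0 (symPart L i j) +
      AddMonoidAlgebra.single 1 (lowerPart (altPart L) i j) +
      AddMonoidAlgebra.single (-1) (lowerPart (altPart L) j i)

theorem toLoop_coeff (L : Gl n) (i j : Fin n) (m : ℤ) :
    (toLoop L i j).coeff m = (if m = 0 then symPart L i j else 0) +
      (if m = 1 then lowerPart (altPart L) i j else 0) +
      (if m = -1 then lowerPart (altPart L) j i else 0) := by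
  simp only [toLoop, Matrix.of_apply, AddMonoidAlgebra.coeff_add, AddMonoidAlgebra.coeff_single,
    Finsupp.add_apply, Finsupp.single_apply, eq_comm (b := m)]

theorem symPart_apply (L : Gl n) (i j : Fin n) : symPart L i j = (L i j + L j i) / 2 := by
  simp [symPart]; ring

theorem altPart_apply (L : Gl n) (i j : Fin n) : altPart L i j = (L i j - L j i) / 2 := by
  simp [altPart]; ring

theorem lowerPart_apply (L : Gl n) (i j : Fin n) :
    lowerPart L i j = if j < i then L i j else 0 := rfl

theorem toLoop_mem (L : Gl n) : toLoop L ∈ phaseSpace n := by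
  refine ⟨(mem_symmElts_iff _).2 fun i j m => ?_, fun i j m h => ?_⟩
  · simp only [toLoop_coeff, symPart_apply, neg_eq_zero, neg_inj, neg_eq_iff_eq_neg (b := (1 : ℤ))]
    rw [add_comm (L j i)]
    ring
  · have hi : (i : ℤ) < n := by exact_mod_cast i.2
    have hj : (j : ℤ) < n := by exact_mod_cast j.2
    have hi0 : (0 : ℤ) ≤ i := by positivity
    have hj0 : (0 : ℤ) ≤ j := by positivity
    have h0 : m ≠ 0 := by rintro rfl; linarith
    have h1 : m ≠ -1 := by rintro rfl; linarith
    rw [toLoop_coeff, if_neg h0, if_neg h1, zero_add, add_zero]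
    split_ifs with hm
    · subst hm
      rw [lowerPart_apply, if_neg]
      intro hlt
      have : (j : ℤ) < i := by exact_mod_cast hlt
      linarith
    · rfl

/-- The isomorphism `L₀ + L₁ λ + L₁ᵗ λ⁻¹ ↦ L₀ + L₁ - L₁ᵗ` of vector spaces. -/
def Phi (n : ℕ) : phaseSpace n ≃ₗ[ℝ] Gl n where
  toFun L := loopCoeff 0 (L : Loop n) + loopCoeff 1 (L : Loop n) -
    (loopCoeff 1 (L : Loop n)).transpose
  map_add' L M := by
    simp only [Submodule.coe_add, map_add, Matrix.transpose_add]; abel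
  map_smul' c L := by
    simp only [Submodule.coe_smul, map_smul, Matrix.transpose_smul, RingHom.id_apply, smul_add,
      smul_sub]
  invFun L := ⟨toLoop L, toLoop_mem L⟩
  left_inv := by
    rintro ⟨L, hs, hd⟩
    replace hs := (mem_symmElts_iff L).1 hs
    apply Subtype.ext
    ext i j m
    have hi : (i : ℤ) < n := by exact_mod_cast i.2
    have hj : (j : ℤ) < n := by exact_mod_cast j.2
    have hi0 : (0 : ℤ) ≤ i := by positivity
    have hj0 : (0 : ℤ) ≤ j := by positivity
    have hup : ∀ a b : Fin n, a ≤ b → (L a b).coeff 1 = 0 := by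
      intro a b hab
      apply hd
      have : (a : ℤ) ≤ b := by exact_mod_cast hab
      linarith
    have hs0 := hs i j 0
    rw [neg_zero] at hs0
    have hs1 := hs i j 1
    have hs2 := hs j i 1
    simp only [toLoop_coeff, lowerPart_apply, symPart_apply, altPart_apply, loopCoeff,
      LinearMap.coe_mk, AddHom.coe_mk, Matrix.sub_apply, Matrix.add_apply, Matrix.transpose_apply,
      Matrix.of_apply]
    by_cases h0 : m = 0
    · subst h0
      simp only [↓reduceIte, zero_ne_one, zero_eq_neg, one_ne_zero, hs0]
      ring
    by_cases h1 : m = 1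
    · subst h1
      rcases lt_or_ge j i with h | h
      · have := hup j i h.le
        simp only [if_pos h, hs0, this]
        norm_num
      · simp [hup i j h, not_lt.2 h]
    by_cases h2 : m = -1
    · subst h2
      rcases lt_or_ge i j with h | h
      · have := hup i j h.le
        simp only [if_pos h, hs0, this, hs2]
        norm_num
      · rw [hs2]
        simp [hup j i h, not_lt.2 h]
    · simp only [if_neg h0, if_neg h1, if_neg h2, add_zero]
      symm
      rcases lt_or_gt_of_ne h0 with h | h
      · rw [← hs]
        apply hd
        have : 2 ≤ -m := by omega
        nlinarith
      · apply hd
        have : 2 ≤ m := by omega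
        nlinarith
  right_inv := by
    intro L
    ext i j
    simp only [loopCoeff, LinearMap.coe_mk, AddHom.coe_mk, Matrix.sub_apply, Matrix.add_apply,
      Matrix.transpose_apply, Matrix.of_apply, toLoop_coeff, lowerPart_apply, symPart_apply,
      altPart_apply]
    rcases lt_trichotomy i j with h | h | h
    · simp [h, not_lt.2 h.le]; ring
    · subst h; simp
    · simp [h, not_lt.2 h.le]; ring

/-! ### Poisson brackets on `gl(n)` -/

/-- Smooth real functions on `gl(n)`. -/
abbrev Smooth (f : Gl n → ℝ) : Prop := ContDiff ℝ ∞ f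

/-- The gradient with respect to the scalar product `((·, ·))`. -/
def grad (f : Gl n → ℝ) (L : Gl n) : Gl n :=
  Matrix.of fun i j => fderiv ℝ f L (Matrix.single i j 1)

theorem glInner_grad (f : Gl n → ℝ) (L M : Gl n) :
    glInner (grad f L) M = fderiv ℝ f L M := by
  conv_rhs => rw [Matrix.matrix_eq_sum_single M]
  simp only [map_sum, glInner, grad, Matrix.trace, Matrix.diag_apply, Matrix.mul_apply,
    Matrix.transpose_apply, Matrix.of_apply]
  refine Finset.sum_congr rfl fun i _ => Finset.sum_congr rfl fun j _ => ?_
  have : Matrix.single i j (M i j) = M i j • Matrix.single i j (1 : ℝ) := by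
    rw [Matrix.smul_single, smul_eq_mul, mul_one]
  rw [this, map_smul, smul_eq_mul, mul_comm]

/-- A binary operation on the real functions on `gl(n)`; it is only of interest on smooth
functions. -/
abbrev Bracket (n : ℕ) : Type := (Gl n → ℝ) → (Gl n → ℝ) → Gl n → ℝ

/-- Poisson brackets on the smooth functions on `gl(n)`. -/
structure IsPoisson (b : Bracket n) : Prop where
  smooth : ∀ f g, Smooth f → Smooth g → Smooth (b f g)
  add_left : ∀ f g h, Smooth f → Smooth g → Smooth h → b (f + g) h = b f h + b g h
  smul_left : ∀ (c : ℝ) f g, Smooth f → Smooth g → b (c • f) g = c • b f g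
  skew : ∀ f g, Smooth f → Smooth g → b f g = -b g f
  leibniz : ∀ f g h, Smooth f → Smooth g → Smooth h → b f (g * h) = b f g * h + g * b f h
  jacobi : ∀ f g h, Smooth f → Smooth g → Smooth h →
    b f (b g h) + b g (b h f) + b h (b f g) = 0

/-- Two Poisson brackets are compatible if every member of their pencil is a Poisson bracket. -/
def Compatible (p q : Bracket n) : Prop :=
  IsPoisson p ∧ IsPoisson q ∧ ∀ c : ℝ, IsPoisson fun f g => q f g - c • p f g

/-- A trihamiltonian structure: three mutually compatible Poisson brackets. -/
def IsTrihamiltonian (p q s : Bracket n) : Prop :=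
  Compatible p q ∧ Compatible p s ∧ Compatible q s

/-- The action of a vector field on functions. -/
def vectorDeriv (X : Gl n → Gl n) (f : Gl n → ℝ) (L : Gl n) : ℝ := fderiv ℝ f L (X L)

/-- The bracket of the Lie derivative along `X` of the tensor of the bracket `b`. -/
def lieDeriv (X : Gl n → Gl n) (b : Bracket n) : Bracket n := fun f g =>
  vectorDeriv X (b f g) - b (vectorDeriv X f) g - b f (vectorDeriv X g)

/-- The bracket on `gl(n)` obtained by restricting to `𝔊⁺ₙ₋₁` the tensor `P` of the loop algebra and
carrying it along `Φ`. The gradient in `𝔊⁺ₙ₋₁` of `f ∘ Φ` is the image of `∇f` under the inverse of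
`Φ`. -/
def carried (P : Loop n → Loop n → Loop n → ℝ) : Bracket n := fun f g L =>
  P ((Phi n).symm L : Loop n) ((Phi n).symm (grad f L) : Loop n) ((Phi n).symm (grad g L) : Loop n)

/-- The tensor `P` of the loop algebra reduces by restriction to `𝔊⁺ₙ₋₁`, and the reduced bracket,
carried on `gl(n)` by `Φ`, is `b`: if `A` and `B` are the gradients, at a point `L` of `𝔊⁺ₙ₋₁`, of
any extensions to the loop algebra of `f ∘ Φ` and `g ∘ Φ`, then `{f, g}` at `Φ L` is the value of
`P` at `L` on `A` and `B`. -/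
def IsReduction (P : Loop n → Loop n → Loop n → ℝ) (b : Bracket n) : Prop :=
  ∀ f g : Gl n → ℝ, Smooth f → Smooth g → ∀ (L : phaseSpace n) (A B : Loop n),
    (∀ M : phaseSpace n, loopInner A M = fderiv ℝ f (Phi n L) (Phi n M)) →
    (∀ M : phaseSpace n, loopInner B M = fderiv ℝ g (Phi n L) (Phi n M)) →
    b f g (Phi n L) = P L A B

/-- The Semenov-Tian-Shansky bracket on `gl(n)`. -/
def semBracket (n : ℕ) : Bracket n := carried loopSem

/-- The Sklyanin bracket on `gl(n)`. -/
def sklBracket (n : ℕ) : Bracket n := carried loopSkl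

/-- The bracket `{f, g}(L) = ((L, [[∇f, ∇g]]))`. -/
def linBracket (n : ℕ) : Bracket n := fun f g L => glInner L (nsBracket (grad f L) (grad g L))

/-- The vector field `X(L) = ρ(L_A)`. -/
def fieldX (L : Gl n) : Gl n := rho (altPart L)

/-- The vector field `Y(L) = L ⊙ ρ(L_A)`. -/
def fieldY (L : Gl n) : Gl n := odot L (rho (altPart L))

end Kupershmidt

end

/-!
All tensors that occur are polynomial of degree at most two in the base point, and the Jacobi
identity of the bracket of such a tensor is an algebraic condition, because the second derivatives
of the functions cancel (`jacobi_tensorBracket`).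

*Sklyanin bracket.* The algebra `𝔊` is graded by powers of `Δ`. On symmetric elements `R` is the
difference of the projections onto positive and negative powers, up to a multiple of the identity
which does not contribute to the tensor of symmetric gradients. So the tensor is
the Sklyanin tensor of the skewsymmetric r-matrix `signPart` (`loopSkl_eq_sklPolar`), which solves
the modified Yang-Baxter equation (`signPart_yangBaxter`); this equation, applied to the products
`A L` and to the products `L A`, gives the Jacobi identity (`sklPolar_jacobi`). The Hamiltonian
vectors are tangent to the phase space (`sklHam_mem`), so nothing is lost by restriction.

*Reduction.* For arbitrary gradients the tensor has to be paired with an arbitrary loop. Computing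
the adjoint of `R` explicitly, one finds that `P_Skl(L)(·, B)` is the pairing with an element of the
phase space (`exists_loopSkl_eq`), so it depends on its argument only through the restriction of the
corresponding linear form to the phase space. As `L • A` becomes `L • A + A` when `1` is added to
`L`, the Semenov-Tian-Shansky tensor is the increment of the Sklyanin tensor under this shift
(`loopSem_eq`), and inherits this property.

*Semenov-Tian-Shansky bracket.* By the same relation it is the Lie derivative of the Sklyanin bracket
along the constant vector field `1`, and it is itself invariant under that field. Differentiating the
Jacobi identity of the Sklyanin bracket once gives the compatibility of the two brackets
(`mixed_of_lieDeriv`), differentiating it twice gives the Jacobi identity of the second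
(`jacobi_of_lieDeriv`).

*Linear bracket.* The value at `λ = i` of the loop of `L` is the Hermitian matrix `L_S + i L_A`. In
these terms `[[·, ·]]` is `i` times the commutator, `⊙` is the product `•`, and `((·, ·))` is the
trace form (`herm_nsBracket`, `herm_odot`, `glInner_eq_reTrace`); the linear bracket is the
Lie-Poisson bracket of Hermitian matrices.

*Lie derivatives of the linear bracket.* The trace of a product at `λ = i` is compared with the
coefficient of `λ ^ 0` through the coefficients of `λ ^ 2` and `λ ^ (-2)`. These enter as traces
with the derivation `λ d/dλ`: the terms in which `ρ` is differentiated give the Sklyanin tensor and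
such a trace (`glInner_odot_rho_altPart`), the others give only such a trace
(`glInner_odot_rho_nsBracket`), and the traces cancel by an identity which holds for every derivation
(`trace_loopEuler_identity`). This is the statement for `Y`. The shift of `L` by `1` changes `Y` by
`X` and leaves `[[L, ·]]` unchanged, which gives the statement for `X`. Being Lie derivatives of the
linear bracket, both of the other brackets are compatible with it.
-/

noncomputable section

namespace Kupershmidt

variable {n : ℕ}

/-! ### Brackets given by tensors on a finite dimensional space -/

section Tensor

variable {E : Type*} [NormedAddCommGroup E] [NormedSpace ℝ E] [FiniteDimensional ℝ E]

/-- The gradient of a function with respect to the identification `r` of covectors and vectors. -/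
def gradient (r : (E →L[ℝ] ℝ) →ₗ[ℝ] E) (f : E → ℝ) (x : E) : E := r (fderiv ℝ f x)

/-- The bracket of a field of bilinear forms on gradients. -/
def tensorBracket (r : (E →L[ℝ] ℝ) →ₗ[ℝ] E) (B : E → E →ₗ[ℝ] E →ₗ[ℝ] ℝ) (f g : E → ℝ) (x : E) : ℝ :=
  B x (gradient r f x) (gradient r g x)

/-- The derivative of the function `f` along the vector field `X`. -/
def dirDeriv (X : E → E) (f : E → ℝ) (x : E) : ℝ := fderiv ℝ f x (X x)

theorem hasFDerivAt_gradient (r : (E →L[ℝ] ℝ) →ₗ[ℝ] E) {f : E → ℝ} (hf : ContDiff ℝ ∞ f) (x : E) :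
    HasFDerivAt (gradient r f) (r.toContinuousLinearMap ∘L (fderiv ℝ (fderiv ℝ f) x)) x :=
  r.toContinuousLinearMap.hasFDerivAt.comp x
    (((hf.fderiv_right (m := ∞) (by simp)).differentiable (by simp)).differentiableAt.hasFDerivAt)

theorem contDiff_gradient (r : (E →L[ℝ] ℝ) →ₗ[ℝ] E) {f : E → ℝ} (hf : ContDiff ℝ ∞ f) :
    ContDiff ℝ ∞ (gradient r f) :=
  r.toContinuousLinearMap.contDiff.comp (hf.fderiv_right (m := ∞) (by simp))

omit [FiniteDimensional ℝ E] in
theorem fderiv_fderiv_comm {f : E → ℝ} (hf : ContDiff ℝ ∞ f) (x v w : E) :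
    fderiv ℝ (fderiv ℝ f) x v w = fderiv ℝ (fderiv ℝ f) x w v :=
  (hf.contDiffAt.isSymmSndFDerivAt
    (by rw [minSmoothness_of_isRCLikeNormedField]; exact WithTop.coe_le_coe.2 le_top)) v w

/-- A polynomial map of degree at most two without constant term is smooth, and its derivative is
given by the product rule. -/
theorem contDiff_quadratic {F : Type*} [NormedAddCommGroup F] [NormedSpace ℝ F]
    (K : E →ₗ[ℝ] F) (N : E →ₗ[ℝ] E →ₗ[ℝ] F) :
    ContDiff ℝ ∞ (fun x => K x + N x x) ∧
      ∀ x w, fderiv ℝ (fun x => K x + N x x) x w = K w + (N w x + N x w) := by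
  have h (x : E) := ((K.toContinuousLinearMap).hasFDerivAt (x := x)).add
    (((LinearMap.toContinuousBilinearMap N).hasFDerivAt (x := x)).clm_apply (hasFDerivAt_id x))
  refine ⟨K.toContinuousLinearMap.contDiff.add
    ((LinearMap.toContinuousBilinearMap N).contDiff.clm_apply contDiff_id), fun x w => ?_⟩
  have h' : HasFDerivAt (fun x => K x + N x x) _ x := h x
  rw [h'.fderiv, add_comm (N w x)]
  rfl

variable {r : (E →L[ℝ] ℝ) →ₗ[ℝ] E} {ip : E → E → ℝ} (hr : ∀ φ v, ip v (r φ) = φ v)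
  {B : E → E →ₗ[ℝ] E →ₗ[ℝ] ℝ} {K : E → E → E →ₗ[ℝ] ℝ} {Q : E → E → E →ₗ[ℝ] E →ₗ[ℝ] ℝ}
  (hB : ∀ x a b, B x a b = K a b x + Q a b x x)

include hB in
theorem contDiff_toContinuousBilinearMap :
    ContDiff ℝ ∞ (fun x => LinearMap.toContinuousBilinearMap (B x)) := by
  rw [contDiff_clm_apply_iff]
  intro a
  rw [contDiff_clm_apply_iff]
  intro b
  have : (fun x => LinearMap.toContinuousBilinearMap (B x) a b) = fun x => K a b x + Q a b x x := by
    ext x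
    exact hB x a b
  rw [this]
  exact (contDiff_quadratic (K a b) (Q a b)).1

include hB in
theorem contDiff_tensorBracket {f g : E → ℝ} (hf : ContDiff ℝ ∞ f) (hg : ContDiff ℝ ∞ g) :
    ContDiff ℝ ∞ (tensorBracket r B f g) :=
  ((contDiff_toContinuousBilinearMap hB).clm_apply (contDiff_gradient r hf)).clm_apply
    (contDiff_gradient r hg)

variable (skew : ∀ x a b, B x a b = -B x b a) {V : E → E → E} (hV : ∀ x a b, B x a b = ip (V x a) b)

include hr hB skew hV in
/-- The derivative of a bracket. The second derivatives of the functions enter through the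
Hamiltonian vectors `V x a`. -/
theorem fderiv_tensorBracket {f g : E → ℝ} (hf : ContDiff ℝ ∞ f) (hg : ContDiff ℝ ∞ g) (x w : E) :
    fderiv ℝ (tensorBracket r B f g) x w =
      K (gradient r f x) (gradient r g x) w
      + (Q (gradient r f x) (gradient r g x) w x + Q (gradient r f x) (gradient r g x) x w)
      - fderiv ℝ (fderiv ℝ f) x w (V x (gradient r g x))
      + fderiv ℝ (fderiv ℝ g) x w (V x (gradient r f x)) := by
  have hP := contDiff_toContinuousBilinearMap hB
  have hPx := ((hP.differentiable (by simp)).differentiableAt (x := x)).hasFDerivAt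
  have h := (hPx.clm_apply (hasFDerivAt_gradient r hf x)).clm_apply (hasFDerivAt_gradient r hg x)
  have h' : HasFDerivAt (tensorBracket r B f g) _ x := h
  have hc (a b : E) : fderiv ℝ (fun x => LinearMap.toContinuousBilinearMap (B x)) x w a b =
      K a b w + (Q a b w x + Q a b x w) := by
    have h1 := (hPx.clm_apply (hasFDerivAt_const a x)).clm_apply (hasFDerivAt_const b x)
    have h2 : (fun x => LinearMap.toContinuousBilinearMap (B x) a b) = fun x => K a b x + Q a b x x := by
      ext x
      exact hB x a b
    rw [← (contDiff_quadratic (K a b) (Q a b)).2, ← h2, h1.fderiv]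
    simp
  rw [h'.fderiv, ← hc]
  simp only [add_apply, ContinuousLinearMap.comp_apply,
    ContinuousLinearMap.flip_apply, LinearMap.toContinuousBilinearMap_apply]
  have e1 (φ : E →L[ℝ] ℝ) (a : E) : B x a (r.toContinuousLinearMap φ) = φ (V x a) := by
    rw [hV]; exact hr _ _
  rw [skew x (r.toContinuousLinearMap _), e1, e1]
  ring

omit [FiniteDimensional ℝ E] in
include hr hV in
theorem tensorBracket_right (f F : E → ℝ) (x : E) :
    tensorBracket r B f F x = fderiv ℝ F x (V x (gradient r f x)) := by
  rw [tensorBracket, hV, gradient, gradient, hr]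

include hr hB skew hV in
/-- The Jacobi identity of a bracket is an algebraic condition on its tensor, since the second
derivatives of the functions cancel. -/
theorem jacobi_tensorBracket
    (jacobi : ∀ x a b c, K b c (V x a) + (Q b c (V x a) x + Q b c x (V x a))
      + (K c a (V x b) + (Q c a (V x b) x + Q c a x (V x b)))
      + (K a b (V x c) + (Q a b (V x c) x + Q a b x (V x c))) = 0) {f g h : E → ℝ} (hf : ContDiff ℝ ∞ f)
    (hg : ContDiff ℝ ∞ g) (hh : ContDiff ℝ ∞ h) :
    tensorBracket r B f (tensorBracket r B g h) + tensorBracket r B g (tensorBracket r B h f) +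
      tensorBracket r B h (tensorBracket r B f g) = 0 := by
  ext x
  simp only [Pi.add_apply, tensorBracket_right hr hV _ (tensorBracket r B _ _), Pi.zero_apply,
    fderiv_tensorBracket hr hB skew hV hg hh, fderiv_tensorBracket hr hB skew hV hh hf,
    fderiv_tensorBracket hr hB skew hV hf hg]
  have := jacobi x (gradient r f x) (gradient r g x) (gradient r h x)
  rw [fderiv_fderiv_comm hf _ (V x (gradient r h x)), fderiv_fderiv_comm hg _ (V x (gradient r h x)),
    fderiv_fderiv_comm hh _ (V x (gradient r g x))]
  linarith

omit [FiniteDimensional ℝ E] in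
theorem contDiff_dirDeriv {X : E → E} (hX : ContDiff ℝ ∞ X) {f : E → ℝ} (hf : ContDiff ℝ ∞ f) :
    ContDiff ℝ ∞ (dirDeriv X f) :=
  (hf.fderiv_right (m := ∞) (by simp)).clm_apply hX

omit [FiniteDimensional ℝ E] in
theorem fderiv_dirDeriv {X : E → E} (hX : ContDiff ℝ ∞ X) {f : E → ℝ} (hf : ContDiff ℝ ∞ f)
    (x w : E) : fderiv ℝ (dirDeriv X f) x w =
      fderiv ℝ (fderiv ℝ f) x w (X x) + fderiv ℝ f x (fderiv ℝ X x w) := by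
  have h := (((hf.fderiv_right (m := ∞) (by simp)).differentiable
    (by simp)).differentiableAt (x := x)).hasFDerivAt.clm_apply
    ((hX.differentiable (by simp)).differentiableAt (x := x)).hasFDerivAt
  have h' : HasFDerivAt (dirDeriv X f) _ x := h
  rw [h'.fderiv]
  simp only [add_apply, ContinuousLinearMap.comp_apply,
    ContinuousLinearMap.flip_apply]
  ring

include hr hB skew hV in
/-- The tensor of the Lie derivative of a bracket. -/
theorem dirDeriv_tensorBracket {X : E → E} (hX : ContDiff ℝ ∞ X) {DX : E → E → E}
    (hDX : ∀ x w, fderiv ℝ X x w = DX x w) {f g : E → ℝ} (hf : ContDiff ℝ ∞ f)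
    (hg : ContDiff ℝ ∞ g) (x : E) :
    dirDeriv X (tensorBracket r B f g) x - tensorBracket r B (dirDeriv X f) g x
      - tensorBracket r B f (dirDeriv X g) x =
      K (gradient r f x) (gradient r g x) (X x)
      + (Q (gradient r f x) (gradient r g x) (X x) x + Q (gradient r f x) (gradient r g x) x (X x))
      + ip (DX x (V x (gradient r g x))) (gradient r f x)
      - ip (DX x (V x (gradient r f x))) (gradient r g x) := by
  have h1 : tensorBracket r B (dirDeriv X f) g x = - tensorBracket r B g (dirDeriv X f) x :=
    skew _ _ _
  rw [h1, tensorBracket_right hr hV, tensorBracket_right hr hV, fderiv_dirDeriv hX hf,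
    fderiv_dirDeriv hX hg, dirDeriv, fderiv_tensorBracket hr hB skew hV hf hg,
    fderiv_fderiv_comm hf _ (X x), fderiv_fderiv_comm hg _ (X x), hDX, hDX, gradient, gradient,
    hr, hr]
  ring

end Tensor

/-! ### Brackets given by tensors on `gl(n)` -/

/-- The matrix that represents a linear form with respect to the scalar product `((·, ·))`. -/
def rieszGl (n : ℕ) : (Gl n →L[ℝ] ℝ) →ₗ[ℝ] Gl n where
  toFun φ := Matrix.of fun i j => φ (Matrix.single i j 1)
  map_add' φ ψ := by ext i j; rfl
  map_smul' c φ := by ext i j; rfl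

theorem glInner_rieszGl (φ : Gl n →L[ℝ] ℝ) (M : Gl n) : glInner M (rieszGl n φ) = φ M := by
  conv_rhs => rw [Matrix.matrix_eq_sum_single M]
  simp only [map_sum, glInner, rieszGl, Matrix.trace, Matrix.diag_apply, Matrix.mul_apply,
    Matrix.transpose_apply, Matrix.of_apply, LinearMap.coe_mk, AddHom.coe_mk]
  refine Finset.sum_congr rfl fun i _ => Finset.sum_congr rfl fun j _ => ?_
  have : Matrix.single i j (M i j) = M i j • Matrix.single i j (1 : ℝ) := by
    rw [Matrix.smul_single, smul_eq_mul, mul_one]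
  rw [this, map_smul, smul_eq_mul]

theorem fderiv_add_apply {E : Type*} [NormedAddCommGroup E] [NormedSpace ℝ E] {f g : E → ℝ}
    (hf : ContDiff ℝ ∞ f) (hg : ContDiff ℝ ∞ g) (x v : E) :
    fderiv ℝ (f + g) x v = fderiv ℝ f x v + fderiv ℝ g x v := by
  rw [fderiv_add (hf.differentiable (by simp) x) (hg.differentiable (by simp) x)]; rfl

theorem fderiv_smul_apply {E : Type*} [NormedAddCommGroup E] [NormedSpace ℝ E] (c : ℝ) {f : E → ℝ}
    (hf : ContDiff ℝ ∞ f) (x v : E) : fderiv ℝ (c • f) x v = c * fderiv ℝ f x v := by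
  rw [fderiv_const_smul (hf.differentiable (by simp) x)]; rfl

theorem fderiv_mul_apply {E : Type*} [NormedAddCommGroup E] [NormedSpace ℝ E] {f g : E → ℝ}
    (hf : ContDiff ℝ ∞ f) (hg : ContDiff ℝ ∞ g) (x v : E) :
    fderiv ℝ (f * g) x v = f x * fderiv ℝ g x v + g x * fderiv ℝ f x v := by
  rw [fderiv_mul (hf.differentiable (by simp) x) (hg.differentiable (by simp) x)]; rfl

theorem grad_add {f g : Gl n → ℝ} (hf : Smooth f) (hg : Smooth g) (L : Gl n) :
    grad (f + g) L = grad f L + grad g L := by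
  ext i j
  exact fderiv_add_apply hf hg L _

theorem grad_smul (c : ℝ) {f : Gl n → ℝ} (hf : Smooth f) (L : Gl n) :
    grad (c • f) L = c • grad f L := by
  ext i j
  exact fderiv_smul_apply c hf L _

theorem grad_mul {f g : Gl n → ℝ} (hf : Smooth f) (hg : Smooth g) (L : Gl n) :
    grad (f * g) L = f L • grad g L + g L • grad f L := by
  ext i j
  exact fderiv_mul_apply hf hg L _

/-- A bivector field on `gl(n)` that is polynomial of degree at most two in the base point: `form`
are its values on pairs of gradients, `lin` is its linear part with respect to the base point, `quad`
is a polarization of its quadratic part, and `ham` are its Hamiltonian vectors. -/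
structure Bivector (n : ℕ) where
  form : Gl n → Gl n →ₗ[ℝ] Gl n →ₗ[ℝ] ℝ
  lin : Gl n → Gl n → Gl n →ₗ[ℝ] ℝ
  quad : Gl n → Gl n → Gl n →ₗ[ℝ] Gl n →ₗ[ℝ] ℝ
  ham : Gl n → Gl n → Gl n
  form_eq : ∀ L A B, form L A B = lin A B L + quad A B L L
  skew : ∀ L A B, form L A B = -form L B A
  ham_eq : ∀ L A B, form L A B = glInner (ham L A) B

namespace Bivector

/-- The bracket of a bivector field. -/
def bracket (P : Bivector n) : Bracket n := fun f g L => P.form L (grad f L) (grad g L)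

/-- The derivative of a bivector field in the direction `W`. -/
def deriv (P : Bivector n) (L W A B : Gl n) : ℝ :=
  P.lin A B W + (P.quad A B W L + P.quad A B L W)

theorem smooth_bracket (P : Bivector n) {f g : Gl n → ℝ} (hf : Smooth f) (hg : Smooth g) :
    Smooth (P.bracket f g) :=
  contDiff_tensorBracket (r := rieszGl n) P.form_eq hf hg

theorem bracket_add_right (P : Bivector n) {f g h : Gl n → ℝ} (hg : Smooth g) (hh : Smooth h) :
    P.bracket f (g + h) = P.bracket f g + P.bracket f h := by
  ext L
  simp [bracket, grad_add hg hh]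

theorem isPoisson_of_jacobi (P : Bivector n)
    (jacobi : ∀ f g h, Smooth f → Smooth g → Smooth h → P.bracket f (P.bracket g h)
      + P.bracket g (P.bracket h f) + P.bracket h (P.bracket f g) = 0) : IsPoisson P.bracket where
  smooth f g hf hg := P.smooth_bracket hf hg
  add_left f g h hf hg hh := by
    ext L
    simp [bracket, grad_add hf hg]
  smul_left c f g hf hg := by
    ext L
    simp [bracket, grad_smul c hf]
  skew f g hf hg := by
    ext L
    exact P.skew _ _ _
  leibniz f g h hf hg hh := by
    ext L
    simp only [bracket, grad_mul hg hh, map_add, map_smul, Pi.add_apply, Pi.mul_apply, smul_eq_mul]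
    ring
  jacobi := jacobi

theorem isPoisson_bracket (P : Bivector n)
    (jacobi : ∀ L A B C, P.deriv L (P.ham L A) B C + P.deriv L (P.ham L B) C A
      + P.deriv L (P.ham L C) A B = 0) : IsPoisson P.bracket :=
  P.isPoisson_of_jacobi fun _ _ _ hf hg hh =>
    jacobi_tensorBracket (r := rieszGl n) glInner_rieszGl P.form_eq P.skew P.ham_eq jacobi hf hg hh

/-- The Lie derivative of a bivector field along the vector field `X` with derivative `DX`. -/
def lie (P : Bivector n) (X : Gl n → Gl n) (DX : Gl n → Gl n → Gl n) (L A B : Gl n) : ℝ :=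
  P.deriv L (X L) A B + glInner (DX L (P.ham L B)) A - glInner (DX L (P.ham L A)) B

theorem lieDeriv_bracket (P : Bivector n) {X : Gl n → Gl n} (hX : ContDiff ℝ ∞ X)
    {DX : Gl n → Gl n → Gl n} (hDX : ∀ L W, fderiv ℝ X L W = DX L W) {f g : Gl n → ℝ}
    (hf : Smooth f) (hg : Smooth g) (L : Gl n) :
    lieDeriv X P.bracket f g L = P.lie X DX L (grad f L) (grad g L) :=
  dirDeriv_tensorBracket (r := rieszGl n) glInner_rieszGl P.form_eq P.skew P.ham_eq hX hDX hf hg L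

end Bivector

theorem smooth_vectorDeriv {X : Gl n → Gl n} (hX : ContDiff ℝ ∞ X) {f : Gl n → ℝ} (hf : Smooth f) :
    Smooth (vectorDeriv X f) :=
  contDiff_dirDeriv hX hf

theorem vectorDeriv_add (X : Gl n → Gl n) {f g : Gl n → ℝ} (hf : Smooth f) (hg : Smooth g) :
    vectorDeriv X (f + g) = vectorDeriv X f + vectorDeriv X g := by
  ext L
  exact fderiv_add_apply hf hg L _

theorem vectorDeriv_zero (X : Gl n → Gl n) : vectorDeriv X (0 : Gl n → ℝ) = 0 := by
  have h := vectorDeriv_add X (f := (0 : Gl n → ℝ)) (g := 0) contDiff_const contDiff_const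
  rw [add_zero] at h
  simpa using h

theorem smooth_add {f g : Gl n → ℝ} (hf : Smooth f) (hg : Smooth g) : Smooth (f + g) :=
  ContDiff.add hf hg

/-! ### Compatibility of a bracket and its Lie derivative -/

/-- The mixed Jacobi identity of two brackets. -/
def Mixed (p q : Bracket n) : Prop := ∀ f g h, Smooth f → Smooth g → Smooth h →
  p f (q g h) + p g (q h f) + p h (q f g) + (q f (p g h) + q g (p h f) + q h (p f g)) = 0

theorem Mixed.symm {p q : Bracket n} (hm : Mixed p q) : Mixed q p := fun f g h hf hg hh => by
  rw [add_comm]; exact hm f g h hf hg hh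

namespace IsPoisson

variable {b p q : Bracket n} {f g h : Gl n → ℝ}

theorem smul_right (hb : IsPoisson b) (c : ℝ) (hf : Smooth f) (hg : Smooth g) :
    b f (c • g) = c • b f g := by
  rw [hb.skew f (c • g) hf (contDiff_const.smul hg), hb.smul_left c g f hg hf, hb.skew f g hf hg,
    smul_neg]

theorem add_right (hb : IsPoisson b) (hf : Smooth f) (hg : Smooth g) (hh : Smooth h) :
    b f (g + h) = b f g + b f h := by
  rw [hb.skew f (g + h) hf (smooth_add hg hh), hb.add_left g h f hg hh hf, hb.skew f g hf hg,
    hb.skew f h hf hh]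
  abel

theorem sub_smul_right (hb : IsPoisson b) (c : ℝ) (hf : Smooth f) (hg : Smooth g) (hh : Smooth h) :
    b f (g - c • h) = b f g - c • b f h := by
  have hs : Smooth ((-c) • h) := contDiff_const.smul hh
  rw [sub_eq_add_neg, ← neg_smul, hb.add_right hf hg hs, hb.smul_right _ hf hh, neg_smul,
    sub_eq_add_neg]

/-- The pencil of two Poisson brackets consists of Poisson brackets if the mixed Jacobi identity
holds. -/
theorem compatible (hp : IsPoisson p) (hq : IsPoisson q) (hm : Mixed p q) : Compatible p q := by
  refine ⟨hp, hq, fun c => ?_⟩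
  have key : ∀ f g h, Smooth f → Smooth g → Smooth h →
      q f (q g h - c • p g h) - c • p f (q g h - c • p g h) =
        q f (q g h) - c • (q f (p g h) + p f (q g h)) + c ^ 2 • p f (p g h) := by
    intro f g h hf hg hh
    have h1 := hp.smooth g h hg hh
    have h2 := hq.smooth g h hg hh
    rw [hq.sub_smul_right c hf h2 h1, hp.sub_smul_right c hf h2 h1]
    module
  refine ⟨fun f g hf hg => ?_, fun f g h hf hg hh => ?_, fun k f g hf hg => ?_,
    fun f g hf hg => ?_, fun f g h hf hg hh => ?_, fun f g h hf hg hh => ?_⟩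
  · exact ContDiff.sub (hq.smooth f g hf hg) (contDiff_const.smul (hp.smooth f g hf hg))
  · rw [hq.add_left f g h hf hg hh, hp.add_left f g h hf hg hh]; module
  · rw [hq.smul_left k f g hf hg, hp.smul_left k f g hf hg]; module
  · rw [hq.skew f g hf hg, hp.skew f g hf hg]; module
  · rw [hq.leibniz f g h hf hg hh, hp.leibniz f g h hf hg hh]
    ext L
    simp only [Pi.add_apply, Pi.sub_apply, Pi.mul_apply, Pi.smul_apply, smul_eq_mul]
    ring
  · simp only [key f g h hf hg hh, key g h f hg hh hf, key h f g hh hf hg]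
    have e1 := hp.jacobi f g h hf hg hh
    have e2 := hq.jacobi f g h hf hg hh
    have e3 := hm f g h hf hg hh
    ext L
    have e1 := congrFun e1 L
    have e2 := congrFun e2 L
    have e3 := congrFun e3 L
    simp only [Pi.add_apply, Pi.sub_apply, Pi.smul_apply, smul_eq_mul, Pi.zero_apply] at e1 e2 e3 ⊢
    linear_combination c ^ 2 * e1 + e2 - c * e3

end IsPoisson

/-- The Leibniz rule for a vector field and a bracket. -/
theorem vectorDeriv_bracket {X : Gl n → Gl n} {b q : Bracket n}
    (hq : ∀ f g, Smooth f → Smooth g → q f g = lieDeriv X b f g) {f g : Gl n → ℝ} (hf : Smooth f)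
    (hg : Smooth g) :
    vectorDeriv X (b f g) = q f g + b (vectorDeriv X f) g + b f (vectorDeriv X g) := by
  rw [hq f g hf hg, lieDeriv]
  abel

/-- A Poisson bracket and its Lie derivative satisfy the mixed Jacobi identity: differentiate the
Jacobi identity along the vector field. -/
theorem mixed_of_lieDeriv {X : Gl n → Gl n} (hX : ContDiff ℝ ∞ X) {b q : Bracket n}
    (hb : IsPoisson b) (hsq : ∀ f g, Smooth f → Smooth g → Smooth (q f g))
    (hq : ∀ f g, Smooth f → Smooth g → q f g = lieDeriv X b f g) : Mixed b q := by
  intro f g h hf hg hh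
  have hXs {f : Gl n → ℝ} (hf : Smooth f) : Smooth (vectorDeriv X f) := smooth_vectorDeriv hX hf
  have key : ∀ f g h, Smooth f → Smooth g → Smooth h → vectorDeriv X (b f (b g h)) =
      q f (b g h) + b (vectorDeriv X f) (b g h) + (b f (q g h) + b f (b (vectorDeriv X g) h)
        + b f (b g (vectorDeriv X h))) := by
    intro f g h hf hg hh
    have h1 := hsq g h hg hh
    have h2 := hb.smooth _ _ (hXs hg) hh
    have h3 := hb.smooth _ _ hg (hXs hh)
    rw [vectorDeriv_bracket hq hf (hb.smooth g h hg hh), vectorDeriv_bracket hq hg hh,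
      hb.add_right hf (smooth_add h1 h2) h3, hb.add_right hf h1 h2]
  have e0 := congrArg (vectorDeriv X) (hb.jacobi f g h hf hg hh)
  have s1 := hb.smooth _ _ hf (hb.smooth _ _ hg hh)
  have s2 := hb.smooth _ _ hg (hb.smooth _ _ hh hf)
  have s3 := hb.smooth _ _ hh (hb.smooth _ _ hf hg)
  rw [vectorDeriv_zero, vectorDeriv_add X (smooth_add s1 s2) s3, vectorDeriv_add X s1 s2,
    key f g h hf hg hh, key g h f hg hh hf, key h f g hh hf hg] at e0
  have e1 := hb.jacobi _ _ _ (hXs hf) hg hh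
  have e2 := hb.jacobi _ _ _ hf (hXs hg) hh
  have e3 := hb.jacobi _ _ _ hf hg (hXs hh)
  linear_combination (exp := 1) e0 - e1 - e2 - e3

/-- If the Lie derivative of a Poisson bracket is invariant under the vector field, it satisfies
the Jacobi identity: differentiate the mixed Jacobi identity along the vector field. -/
theorem jacobi_of_lieDeriv {X : Gl n → Gl n} (hX : ContDiff ℝ ∞ X) {b q : Bracket n}
    (hb : IsPoisson b) (hsq : ∀ f g, Smooth f → Smooth g → Smooth (q f g))
    (hqa : ∀ f g h, Smooth f → Smooth g → Smooth h → q f (g + h) = q f g + q f h)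
    (hq : ∀ f g, Smooth f → Smooth g → q f g = lieDeriv X b f g)
    (hqq : ∀ f g, Smooth f → Smooth g → lieDeriv X q f g = 0) {f g h : Gl n → ℝ} (hf : Smooth f)
    (hg : Smooth g) (hh : Smooth h) : q f (q g h) + q g (q h f) + q h (q f g) = 0 := by
  have hm := mixed_of_lieDeriv hX hb hsq hq
  have hqq' : ∀ f g, Smooth f → Smooth g → (0 : Bracket n) f g = lieDeriv X q f g :=
    fun f g hf hg => (hqq f g hf hg).symm
  have hXs {f : Gl n → ℝ} (hf : Smooth f) : Smooth (vectorDeriv X f) := smooth_vectorDeriv hX hf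
  have key1 : ∀ f g h, Smooth f → Smooth g → Smooth h → vectorDeriv X (b f (q g h)) =
      q f (q g h) + b (vectorDeriv X f) (q g h) + (b f (q (vectorDeriv X g) h)
        + b f (q g (vectorDeriv X h))) := by
    intro f g h hf hg hh
    have h2 := hsq _ _ (hXs hg) hh
    have h3 := hsq _ _ hg (hXs hh)
    rw [vectorDeriv_bracket hq hf (hsq g h hg hh), vectorDeriv_bracket hqq' hg hh, Pi.zero_apply,
      Pi.zero_apply, zero_add, hb.add_right hf h2 h3]
  have key2 : ∀ f g h, Smooth f → Smooth g → Smooth h → vectorDeriv X (q f (b g h)) =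
      q (vectorDeriv X f) (b g h) + (q f (q g h) + q f (b (vectorDeriv X g) h)
        + q f (b g (vectorDeriv X h))) := by
    intro f g h hf hg hh
    have h1 := hsq g h hg hh
    have h2 := hb.smooth _ _ (hXs hg) hh
    have h3 := hb.smooth _ _ hg (hXs hh)
    rw [vectorDeriv_bracket hqq' hf (hb.smooth g h hg hh), vectorDeriv_bracket hq hg hh,
      Pi.zero_apply, Pi.zero_apply, zero_add, hqa _ _ _ hf (smooth_add h1 h2) h3,
      hqa _ _ _ hf h1 h2]
  have e0 := congrArg (vectorDeriv X) (hm f g h hf hg hh)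
  have s1 := hb.smooth _ _ hf (hsq _ _ hg hh)
  have s2 := hb.smooth _ _ hg (hsq _ _ hh hf)
  have s3 := hb.smooth _ _ hh (hsq _ _ hf hg)
  have t1 := hsq _ _ hf (hb.smooth _ _ hg hh)
  have t2 := hsq _ _ hg (hb.smooth _ _ hh hf)
  have t3 := hsq _ _ hh (hb.smooth _ _ hf hg)
  rw [vectorDeriv_zero, vectorDeriv_add X (smooth_add (smooth_add s1 s2) s3)
    (smooth_add (smooth_add t1 t2) t3), vectorDeriv_add X (smooth_add s1 s2) s3,
    vectorDeriv_add X s1 s2, vectorDeriv_add X (smooth_add t1 t2) t3, vectorDeriv_add X t1 t2,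
    key1 f g h hf hg hh, key1 g h f hg hh hf, key1 h f g hh hf hg,
    key2 f g h hf hg hh, key2 g h f hg hh hf, key2 h f g hh hf hg] at e0
  have e1 := hm _ _ _ (hXs hf) hg hh
  have e2 := hm _ _ _ hf (hXs hg) hh
  have e3 := hm _ _ _ hf hg (hXs hh)
  have e4 : (q f (q g h) + q g (q h f) + q h (q f g)) + (q f (q g h) + q g (q h f) + q h (q f g))
      = 0 := by
    linear_combination (exp := 1) e0 - e1 - e2 - e3
  ext L
  exact add_self_eq_zero.1 (congrFun e4 L)

/-! ### The grading of the loop algebra by powers of `Δ` -/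

/-- The power of `Δ` to which the position `(i, j)` of the coefficient of `λ ^ m` belongs. -/
def deg (i j : Fin n) (m : ℤ) : ℤ := (j : ℤ) - i + n * m

theorem deg_add (i j k : Fin n) (m₁ m₂ : ℤ) : deg i k m₁ + deg k j m₂ = deg i j (m₁ + m₂) := by
  simp only [deg]; ring

theorem deg_neg (i j : Fin n) (m : ℤ) : deg j i (-m) = -deg i j m := by
  simp only [deg]; ring

theorem deg_eq_zero {i j : Fin n} {m : ℤ} (h : deg i j m = 0) : i = j ∧ m = 0 := by
  have hi : (i : ℤ) < n := by exact_mod_cast i.2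
  have hj : (j : ℤ) < n := by exact_mod_cast j.2
  have hi0 : (0 : ℤ) ≤ i := by positivity
  have hj0 : (0 : ℤ) ≤ j := by positivity
  rw [deg] at h
  have hm : m = 0 := by
    by_contra hm
    rcases lt_or_gt_of_ne hm with hm | hm <;> nlinarith
  subst hm
  refine ⟨Fin.ext ?_, rfl⟩
  have : (j : ℤ) = i := by linarith
  exact_mod_cast this.symm

/-- The loops whose powers of `Δ` lie in the set `D`. -/
def supp (n : ℕ) (D : Set ℤ) : Submodule ℝ (Loop n) where
  carrier := {L | ∀ (i j : Fin n) (m : ℤ), deg i j m ∉ D → (L i j).coeff m = 0}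
  zero_mem' := by intro i j m _; simp
  add_mem' := by intro L M hL hM i j m h; simp [hL i j m h, hM i j m h]
  smul_mem' := by intro c L hL i j m h; simp [hL i j m h]

theorem mem_degLE_iff (k : ℤ) (L : Loop n) : L ∈ degLE n k ↔ L ∈ supp n (Set.Iic k) := by
  constructor
  · intro h i j m hm
    exact h i j m (by simpa [deg] using hm)
  · intro h i j m hm
    exact h i j m (by simpa [deg] using hm)

theorem supp_mono {D D' : Set ℤ} (h : D ⊆ D') {L : Loop n} (hL : L ∈ supp n D) : L ∈ supp n D' :=
  fun i j m hm => hL i j m fun h' => hm (h h')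

theorem mul_mem_supp {D₁ D₂ D : Set ℤ} (hD : ∀ d₁ ∈ D₁, ∀ d₂ ∈ D₂, d₁ + d₂ ∈ D) {L M : Loop n}
    (hL : L ∈ supp n D₁) (hM : M ∈ supp n D₂) : L * M ∈ supp n D := by
  intro i j m hm
  rw [Matrix.mul_apply, AddMonoidAlgebra.coeff_sum, Finsupp.finsetSum_apply]
  refine Finset.sum_eq_zero fun k _ => ?_
  rw [AddMonoidAlgebra.coeff_mul]
  refine Finset.sum_eq_zero fun m₁ _ => Finset.sum_eq_zero fun m₂ _ => ?_
  dsimp only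
  split_ifs with h
  · by_cases h₁ : deg i k m₁ ∈ D₁
    · by_cases h₂ : deg k j m₂ ∈ D₂
      · exact absurd (by rw [← h, ← deg_add i j k]; exact hD _ h₁ _ h₂) hm
      · rw [hM _ _ _ h₂, mul_zero]
    · rw [hL _ _ _ h₁, zero_mul]
  · rfl

open Classical in
/-- The part of a loop with powers of `Δ` in the set `D`. -/
def gradedPart (D : Set ℤ) : Loop n →ₗ[ℝ] Loop n where
  toFun L := Matrix.of fun i j =>
    AddMonoidAlgebra.ofCoeff ((L i j).coeff.filter fun m => deg i j m ∈ D)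
  map_add' L M := by
    ext i j m
    simp only [Matrix.of_apply, Finsupp.filter_apply, Matrix.add_apply, AddMonoidAlgebra.coeff_add,
      Finsupp.add_apply]
    split_ifs <;> simp
  map_smul' c L := by
    ext i j m
    simp only [Matrix.of_apply, Finsupp.filter_apply, Matrix.smul_apply, AddMonoidAlgebra.coeff_smul,
      Finsupp.smul_apply, RingHom.id_apply]
    split_ifs <;> simp

open Classical in
theorem gradedPart_coeff (D : Set ℤ) (L : Loop n) (i j : Fin n) (m : ℤ) :
    (gradedPart D L i j).coeff m = if deg i j m ∈ D then (L i j).coeff m else 0 := by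
  simp [gradedPart, Finsupp.filter_apply]

theorem gradedPart_mem (D : Set ℤ) (L : Loop n) : gradedPart D L ∈ supp n D := by
  intro i j m h
  rw [gradedPart_coeff, if_neg h]

theorem gradedPart_eq_self {D D' : Set ℤ} (h : D ⊆ D') {L : Loop n} (hL : L ∈ supp n D) :
    gradedPart D' L = L := by
  ext i j m
  rw [gradedPart_coeff]
  split_ifs with hm
  · rfl
  · rw [hL i j m fun h' => hm (h h')]

theorem gradedPart_eq_zero {D D' : Set ℤ} (h : Disjoint D D') {L : Loop n} (hL : L ∈ supp n D) :
    gradedPart D' L = 0 := by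
  ext i j m
  rw [gradedPart_coeff]
  split_ifs with hm
  · rw [hL i j m fun h' => Set.disjoint_left.1 h h' hm]; simp
  · simp

theorem gradedPart_involution (D : Set ℤ) (L : Loop n) :
    gradedPart D (involution L) = involution (gradedPart (-D) L) := by
  ext i j m
  rw [involution_coeff, gradedPart_coeff, gradedPart_coeff, deg_neg, involution_coeff]
  by_cases h : deg i j m ∈ D
  · rw [if_pos h, if_pos (Set.neg_mem_neg.2 h)]
  · rw [if_neg h, if_neg fun h' => h (Set.neg_mem_neg.1 h')]

/-- A loop is the sum of its positive, diagonal and negative parts. -/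
theorem gradedPart_add (L : Loop n) :
    gradedPart (Set.Ioi 0) L + gradedPart {0} L + gradedPart (Set.Iio 0) L = L := by
  ext i j m
  simp only [Matrix.add_apply, AddMonoidAlgebra.coeff_add, Finsupp.add_apply, gradedPart_coeff,
    Set.mem_Ioi, Set.mem_Iio, Set.mem_singleton_iff]
  rcases lt_trichotomy 0 (deg i j m) with h | h | h
  · simp [h, h.ne', h.not_gt]
  · simp [← h]
  · simp [h, h.ne, h.not_gt]

theorem mul_comm_of_mem_supp_zero {L M : Loop n} (hL : L ∈ supp n {0}) (hM : M ∈ supp n {0}) :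
    L * M = M * L := by
  have key : ∀ {L : Loop n}, L ∈ supp n {0} → L = Matrix.diagonal fun i => L i i := by
    intro L hL
    ext i j m
    by_cases h : i = j
    · subst h; simp
    · rw [Matrix.diagonal_apply_ne _ h, hL i j m fun h' => h (deg_eq_zero h').1]
      simp
  rw [key hL, key hM, Matrix.diagonal_mul_diagonal, Matrix.diagonal_mul_diagonal]
  simp only [mul_comm]

/-! ### The involution and the traces -/

theorem involution_eq (L : Loop n) :
    involution L = L.transpose.map (LaurentPolynomial.invert : ℝ[T;T⁻¹] ≃ₐ[ℝ] ℝ[T;T⁻¹]) := rfl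

theorem involution_mul (L M : Loop n) : involution (L * M) = involution M * involution L := by
  simp only [involution_eq, Matrix.transpose_mul, Matrix.map_mul]

theorem involution_involution (L : Loop n) : involution (involution L) = L := by
  ext i j m
  rw [involution_coeff, involution_coeff, neg_neg]

theorem mem_symmElts {L : Loop n} : L ∈ symmElts n ↔ involution L = L := Iff.rfl

theorem mem_skewElts {L : Loop n} : L ∈ skewElts n ↔ involution L = -L := Iff.rfl

/-- The trace of the coefficient of `λ ^ m`. -/
def trCoeff (m : ℤ) : Loop n →ₗ[ℝ] ℝ where
  toFun L := (Matrix.trace L).coeff m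
  map_add' L M := by simp [Matrix.trace_add]
  map_smul' c L := by simp [Matrix.trace_smul]

theorem trCoeff_eq (m : ℤ) (L : Loop n) : trCoeff m L = Matrix.trace (loopCoeff m L) := by
  simp [trCoeff, Matrix.trace, loopCoeff]

theorem loopInner_eq (L M : Loop n) : loopInner L M = trCoeff 0 (L * M) := by
  rw [trCoeff_eq]; rfl

theorem trCoeff_mul_comm (m : ℤ) (L M : Loop n) : trCoeff m (L * M) = trCoeff m (M * L) := by
  simp only [trCoeff, LinearMap.coe_mk, AddHom.coe_mk]
  rw [Matrix.trace_mul_comm]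

theorem trCoeff_involution (m : ℤ) (L : Loop n) : trCoeff m (involution L) = trCoeff (-m) L := by
  rw [trCoeff_eq, trCoeff_eq]
  simp [Matrix.trace, loopCoeff, involution_coeff]

theorem trCoeff_eq_zero {D : Set ℤ} (hD : (0 : ℤ) ∉ D) {L : Loop n} (hL : L ∈ supp n D) :
    trCoeff 0 L = 0 := by
  rw [trCoeff_eq]
  refine Finset.sum_eq_zero fun i _ => hL i i 0 ?_
  simpa [deg] using hD

/-! ### The classical r-matrix -/

/-- The positive part of a loop minus its negative part. -/
def signPart (n : ℕ) : Loop n →ₗ[ℝ] Loop n := gradedPart (Set.Ioi 0) - gradedPart (Set.Iio 0)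

theorem signPart_involution (L : Loop n) : signPart n (involution L) = -involution (signPart n L) := by
  simp [signPart, gradedPart_involution]

theorem signPart_skew (L M : Loop n) :
    trCoeff 0 (signPart n L * M) = -trCoeff 0 (L * signPart n M) := by
  have h {D₁ D₂ D : Set ℤ} (hD : ∀ d₁ ∈ D₁, ∀ d₂ ∈ D₂, d₁ + d₂ ∈ D) (h0 : (0 : ℤ) ∉ D) :
      trCoeff 0 (gradedPart D₁ L * gradedPart D₂ M) = 0 :=
    trCoeff_eq_zero h0 (mul_mem_supp hD (gradedPart_mem _ _) (gradedPart_mem _ _))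
  have h1 := h (D₁ := Set.Ioi 0) (D₂ := Set.Ioi 0) (D := Set.Ioi 0)
    (by intro a ha b hb; simp only [Set.mem_Ioi] at *; omega) (by simp)
  have h2 := h (D₁ := Set.Iio 0) (D₂ := Set.Iio 0) (D := Set.Iio 0)
    (by intro a ha b hb; simp only [Set.mem_Iio] at *; omega) (by simp)
  have h3 := h (D₁ := Set.Ioi 0) (D₂ := {0}) (D := Set.Ioi 0)
    (by intro a ha b hb; simp only [Set.mem_Ioi, Set.mem_singleton_iff] at *; omega) (by simp)
  have h4 := h (D₁ := Set.Iio 0) (D₂ := {0}) (D := Set.Iio 0)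
    (by intro a ha b hb; simp only [Set.mem_Iio, Set.mem_singleton_iff] at *; omega) (by simp)
  have h5 := h (D₁ := {0}) (D₂ := Set.Ioi 0) (D := Set.Ioi 0)
    (by intro a ha b hb; simp only [Set.mem_Ioi, Set.mem_singleton_iff] at *; omega) (by simp)
  have h6 := h (D₁ := {0}) (D₂ := Set.Iio 0) (D := Set.Iio 0)
    (by intro a ha b hb; simp only [Set.mem_Iio, Set.mem_singleton_iff] at *; omega) (by simp)
  conv_lhs => rw [← gradedPart_add M]
  conv_rhs => rw [← gradedPart_add L]
  simp only [signPart, LinearMap.sub_apply, mul_add, add_mul, mul_sub, sub_mul, map_add, map_sub,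
    h1, h2, h3, h4, h5, h6]
  ring

/-- The modified classical Yang-Baxter equation. -/
theorem signPart_yangBaxter (L M : Loop n) :
    ⁅signPart n L, signPart n M⁆ - signPart n (⁅signPart n L, M⁆ + ⁅L, signPart n M⁆) = -⁅L, M⁆ := by
  have sp {L : Loop n} (hL : L ∈ supp n (Set.Ioi 0)) : signPart n L = L := by
    rw [signPart, LinearMap.sub_apply, gradedPart_eq_self subset_rfl hL,
      gradedPart_eq_zero _ hL, sub_zero]
    rw [Set.disjoint_left]; intro a ha hb; simp only [Set.mem_Ioi, Set.mem_Iio] at *; omega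
  have sm {L : Loop n} (hL : L ∈ supp n (Set.Iio 0)) : signPart n L = -L := by
    rw [signPart, LinearMap.sub_apply, gradedPart_eq_self (D := Set.Iio 0) subset_rfl hL,
      gradedPart_eq_zero _ hL, zero_sub]
    rw [Set.disjoint_left]; intro a ha hb; simp only [Set.mem_Ioi, Set.mem_Iio] at *; omega
  have hp {X Y : Loop n} (hX : X ∈ supp n (Set.Ioi 0)) (hY : Y ∈ supp n (Set.Ici 0)) :
      signPart n (X * Y) = X * Y ∧ signPart n (Y * X) = Y * X := by
    constructor
    · refine sp (mul_mem_supp ?_ hX hY)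
      intro a ha b hb; simp only [Set.mem_Ioi, Set.mem_Ici] at *; omega
    · refine sp (mul_mem_supp ?_ hY hX)
      intro a ha b hb; simp only [Set.mem_Ioi, Set.mem_Ici] at *; omega
  have hm {X Y : Loop n} (hX : X ∈ supp n (Set.Iio 0)) (hY : Y ∈ supp n (Set.Iic 0)) :
      signPart n (X * Y) = -(X * Y) ∧ signPart n (Y * X) = -(Y * X) := by
    constructor
    · refine sm (mul_mem_supp ?_ hX hY)
      intro a ha b hb; simp only [Set.mem_Iio, Set.mem_Iic] at *; omega
    · refine sm (mul_mem_supp ?_ hY hX)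
      intro a ha b hb; simp only [Set.mem_Iio, Set.mem_Iic] at *; omega
  have i1 : Set.Ioi (0 : ℤ) ⊆ Set.Ici 0 := Set.Ioi_subset_Ici_self
  have i2 : Set.Iio (0 : ℤ) ⊆ Set.Iic 0 := Set.Iio_subset_Iic_self
  have i3 : {(0 : ℤ)} ⊆ Set.Ici 0 := by simp
  have i4 : {(0 : ℤ)} ⊆ Set.Iic 0 := by simp
  have e1 : signPart n L = gradedPart (Set.Ioi 0) L - gradedPart (Set.Iio 0) L := rfl
  have e2 : signPart n M = gradedPart (Set.Ioi 0) M - gradedPart (Set.Iio 0) M := rfl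
  have hLp := gradedPart_mem (Set.Ioi 0) L
  have hLm := gradedPart_mem (Set.Iio 0) L
  have hL0 := gradedPart_mem {0} L
  have hMp := gradedPart_mem (Set.Ioi 0) M
  have hMm := gradedPart_mem (Set.Iio 0) M
  have hM0 := gradedPart_mem {0} M
  have hL := gradedPart_add L
  have hM := gradedPart_add M
  rw [e1, e2]
  set Lp := gradedPart (Set.Ioi 0) L
  set Lm := gradedPart (Set.Iio 0) L
  set L0 := gradedPart {0} L
  set Mp := gradedPart (Set.Ioi 0) M
  set Mm := gradedPart (Set.Iio 0) M
  set M0 := gradedPart {0} M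
  have h0 := mul_comm_of_mem_supp_zero hL0 hM0
  have e3 : ⁅Lp - Lm, M⁆ + ⁅L, Mp - Mm⁆ = (Lp * Mp + Lp * Mp - (Mp * Lp + Mp * Lp)) -
      (Lm * Mm + Lm * Mm - (Mm * Lm + Mm * Lm)) + (Lp * M0 - M0 * Lp) - (Lm * M0 - M0 * Lm)
      + (L0 * Mp - Mp * L0) - (L0 * Mm - Mm * L0) := by
    rw [← hL, ← hM]
    simp only [Ring.lie_def]
    noncomm_ring
  rw [e3]
  simp only [map_add, map_sub, (hp hLp (supp_mono i1 hMp)).1, (hp hLp (supp_mono i1 hMp)).2,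
    (hm hLm (supp_mono i2 hMm)).1, (hm hLm (supp_mono i2 hMm)).2,
    (hp hLp (supp_mono i3 hM0)).1, (hp hLp (supp_mono i3 hM0)).2,
    (hm hLm (supp_mono i4 hM0)).1, (hm hLm (supp_mono i4 hM0)).2,
    (hp hMp (supp_mono i3 hL0)).1, (hp hMp (supp_mono i3 hL0)).2,
    (hm hMm (supp_mono i4 hL0)).1, (hm hMm (supp_mono i4 hL0)).2]
  rw [← hL, ← hM]
  simp only [Ring.lie_def, mul_add, add_mul, mul_sub, sub_mul, h0]
  abel

/-- The projection onto the skewsymmetric elements along `𝔊₋` sends `L` to `L₊ - *(L₊)`, where `L₊` is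
the part of `L` with positive powers of `Δ`. -/
theorem rMatrix_eq (L : Loop n) : rMatrix n L =
    gradedPart (Set.Ioi 0) L - involution (gradedPart (Set.Ioi 0) L) - (1 / 2 : ℝ) • L := by
  set P := gradedPart (Set.Ioi 0) L with hP
  have h1 : P - involution P ∈ skewElts n := by
    rw [mem_skewElts, map_sub, involution_involution, neg_sub]
  have h2 : L - (P - involution P) ∈ degLE n 0 := by
    intro i j m h
    simp only [Matrix.sub_apply, AddMonoidAlgebra.coeff_sub, Finsupp.sub_apply, involution_coeff, hP,
      gradedPart_coeff, deg_neg]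
    rw [if_pos (by simpa [deg] using h), if_neg (by simp [deg]; linarith)]
    simp
  have h3 : Submodule.projection (skewElts n) (degLE n 0) isCompl_skewElts_degLE L =
      P - involution P := by
    conv_lhs => rw [← add_sub_cancel (P - involution P) L]
    rw [map_add, Submodule.projection_apply_of_mem_left _ h1,
      Submodule.projection_apply_of_mem_right _ h2, add_zero]
  rw [rMatrix, LinearMap.smul_apply, LinearMap.sub_apply,
    Submodule.projection_eq_self_sub_projection isCompl_skewElts_degLE, h3]
  module

theorem rMatrix_eq_of_symm {L : Loop n} (hL : L ∈ symmElts n) :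
    rMatrix n L = signPart n L - (1 / 2 : ℝ) • L := by
  rw [rMatrix_eq, signPart, LinearMap.sub_apply]
  congr 2
  conv_rhs => rw [← mem_symmElts.1 hL, gradedPart_involution]
  simp

/-! ### The Sklyanin tensor of the loop algebra -/

/-- The Sklyanin tensor of the classical r-matrix, polarized with respect to the base point. -/
def sklPolar (L M A B : Loop n) : ℝ :=
  trCoeff 0 (signPart n (A * L) * (B * M)) - trCoeff 0 (signPart n (L * A) * (M * B))

/-- The Hamiltonian vectors of the Sklyanin tensor. -/
def sklHam (L A : Loop n) : Loop n := L * signPart n (A * L) - signPart n (L * A) * L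

theorem sklPolar_self (L A B : Loop n) : sklPolar L L A B = trCoeff 0 (sklHam L A * B) := by
  rw [sklPolar, sklHam, sub_mul, map_sub, trCoeff_mul_comm 0 (L * _) B, ← mul_assoc B,
    trCoeff_mul_comm 0 (B * L), mul_assoc (signPart n (L * A))]

theorem sklPolar_skew (L A B : Loop n) : sklPolar L L A B = -sklPolar L L B A := by
  rw [sklPolar, sklPolar, signPart_skew, signPart_skew, trCoeff_mul_comm 0 (A * L),
    trCoeff_mul_comm 0 (L * A)]
  ring

/-- The Yang-Baxter equation paired with a third loop. -/
theorem trCoeff_yangBaxter (a b c : Loop n) :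
    trCoeff 0 (a * ⁅signPart n b, signPart n c⁆) + trCoeff 0 (b * ⁅signPart n c, signPart n a⁆)
      + trCoeff 0 (c * ⁅signPart n a, signPart n b⁆) = -trCoeff 0 (a * ⁅b, c⁆) := by
  have h := congrArg (fun x => trCoeff 0 (a * x)) (signPart_yangBaxter b c)
  simp only [mul_sub, map_sub, mul_neg, map_neg] at h
  have h1 := signPart_skew a (⁅signPart n b, c⁆ + ⁅b, signPart n c⁆)
  have rot : ∀ x y z : Loop n, trCoeff 0 (x * y * z) = trCoeff 0 (y * z * x) := fun x y z => by
    rw [mul_assoc, trCoeff_mul_comm]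
  simp only [Ring.lie_def, mul_add, mul_sub, map_add, map_sub, ← mul_assoc] at h h1 ⊢
  have e1 := rot (signPart n a) (signPart n b) c
  have e2 := rot (signPart n b) c (signPart n a)
  have e3 := rot (signPart n a) c (signPart n b)
  have e4 := rot (signPart n a) b (signPart n c)
  have e5 := rot (signPart n a) (signPart n c) b
  have e6 := rot (signPart n c) b (signPart n a)
  linarith

/-- The Jacobi identity of the Sklyanin tensor, a consequence of the Yang-Baxter equation for the
triples `A L`, `B L`, `C L` and `L A`, `L B`, `L C`. -/
theorem sklPolar_jacobi (L A B C : Loop n) :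
    sklPolar (sklHam L A) L B C + sklPolar L (sklHam L A) B C
      + (sklPolar (sklHam L B) L C A + sklPolar L (sklHam L B) C A)
      + (sklPolar (sklHam L C) L A B + sklPolar L (sklHam L C) A B) = 0 := by
  have h1 := trCoeff_yangBaxter (A * L) (B * L) (C * L)
  have h2 := trCoeff_yangBaxter (L * A) (L * B) (L * C)
  have h3 : trCoeff 0 (A * L * ⁅B * L, C * L⁆) = trCoeff 0 (L * A * ⁅L * B, L * C⁆) := by
    have e (X Y Z : Loop n) :
        trCoeff 0 (X * L * (Y * L * (Z * L))) = trCoeff 0 (L * X * (L * Y * (L * Z))) := by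
      rw [← mul_assoc, ← mul_assoc, trCoeff_mul_comm]
      simp only [mul_assoc]
    simp only [Ring.lie_def, mul_sub, map_sub, e]
  simp only [sklPolar, signPart_skew (_ * sklHam L _), signPart_skew (sklHam L _ * _)]
  simp only [sklHam]
  generalize signPart n (A * L) = p₁ at *
  generalize signPart n (B * L) = p₂ at *
  generalize signPart n (C * L) = p₃ at *
  generalize signPart n (L * A) = q₁ at *
  generalize signPart n (L * B) = q₂ at *
  generalize signPart n (L * C) = q₃ at *
  have h4 := h1.trans ((congrArg Neg.neg h3).trans h2.symm)
  -- every word is rotated so that it begins with `L`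
  have r1 (X Y Z : Loop n) : trCoeff 0 (X * L * Y * Z) = trCoeff 0 (L * Y * Z * X) := by
    rw [mul_assoc, mul_assoc, trCoeff_mul_comm, ← mul_assoc]
  have r2 (X Y Z : Loop n) : trCoeff 0 (X * Y * L * Z) = trCoeff 0 (L * Z * X * Y) := by
    rw [mul_assoc, trCoeff_mul_comm, ← mul_assoc]
  have r3 (X Y Z : Loop n) : trCoeff 0 (X * Y * Z * L) = trCoeff 0 (L * X * Y * Z) := by
    rw [trCoeff_mul_comm, ← mul_assoc, ← mul_assoc]
  clear h1 h2 h3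
  simp only [Ring.lie_def, mul_sub, sub_mul, map_sub, ← mul_assoc, r1, r2, r3] at h4 ⊢
  linarith

theorem mem_phaseSpace {L : Loop n} :
    L ∈ phaseSpace n ↔ involution L = L ∧ L ∈ supp n (Set.Iic ((n : ℤ) - 1)) := by
  rw [phaseSpace, Submodule.mem_inf, mem_degLE_iff, mem_symmElts]

theorem sklHam_mem {L A : Loop n} (hL : L ∈ phaseSpace n) (hA : A ∈ symmElts n) :
    sklHam L A ∈ phaseSpace n := by
  obtain ⟨hs, hd⟩ := mem_phaseSpace.1 hL
  rw [mem_symmElts] at hA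
  refine mem_phaseSpace.2 ⟨?_, ?_⟩
  · rw [sklHam, map_sub, involution_mul, involution_mul, ← neg_neg (involution
      (signPart n (A * L))), ← neg_neg (involution (signPart n (L * A))), ← signPart_involution,
      ← signPart_involution, involution_mul, involution_mul, hA, hs]
    noncomm_ring
  · have key (X : Loop n) : X - signPart n X ∈ supp n (Set.Iic 0) := by
      have : X - signPart n X = gradedPart {0} X + (gradedPart (Set.Iio 0) X
          + gradedPart (Set.Iio 0) X) := by
        nth_rewrite 1 [← gradedPart_add X]
        simp only [signPart, LinearMap.sub_apply]
        abel
      rw [this]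
      have h1 := supp_mono Set.Iio_subset_Iic_self (gradedPart_mem (Set.Iio 0) X)
      exact add_mem (supp_mono (by simp) (gradedPart_mem {0} X)) (add_mem h1 h1)
    have hadd : ∀ a ∈ Set.Iic ((n : ℤ) - 1), ∀ b ∈ Set.Iic (0 : ℤ), a + b ∈ Set.Iic ((n : ℤ) - 1) := by
      intro a ha b hb; simp only [Set.mem_Iic] at *; omega
    have : sklHam L A = (L * A - signPart n (L * A)) * L - L * (A * L - signPart n (A * L)) := by
      rw [sklHam]; noncomm_ring
    rw [this]
    refine sub_mem (mul_mem_supp ?_ (key _) hd) (mul_mem_supp hadd hd (key _))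
    intro a ha b hb; rw [add_comm]; exact hadd b hb a ha

theorem involution_jordan (L M : Loop n) :
    involution (jordan L M) = jordan (involution L) (involution M) := by
  simp only [jordan, map_smul, map_add, involution_mul]
  rw [add_comm]

theorem trCoeff_lie_eq_zero {L A B : Loop n} (hL : involution L = L) (hA : involution A = A)
    (hB : involution B = B) : trCoeff 0 (L * (A * B - B * A)) = 0 := by
  have h := trCoeff_involution 0 (L * (A * B - B * A))
  rw [involution_mul, map_sub, involution_mul, involution_mul, hL, hA, hB, trCoeff_mul_comm,
    ← neg_sub (A * B), mul_neg, map_neg, neg_zero] at h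
  linarith

/-- The Sklyanin tensor in terms of the commutative product. -/
theorem sklPolar_eq_jordan (L A B : Loop n) : sklPolar L L A B =
    trCoeff 0 (signPart n (jordan L A) * (B * L - L * B))
      - trCoeff 0 (signPart n (jordan L B) * (A * L - L * A)) := by
  have s1 := signPart_skew (L * B) (L * A)
  have s2 := signPart_skew (L * B) (A * L)
  have s3 := signPart_skew (B * L) (L * A)
  have s4 := signPart_skew (B * L) (A * L)
  rw [trCoeff_mul_comm 0 (L * B)] at s1 s2
  rw [trCoeff_mul_comm 0 (B * L)] at s3 s4
  simp only [sklPolar, jordan, map_smul, map_add, add_mul, mul_sub, map_sub, smul_mul_assoc,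
    smul_eq_mul]
  linarith

/-- On symmetric elements the Sklyanin tensor of `R` is that of the classical r-matrix: the two maps
differ there by a multiple of the identity, which contributes a multiple of `(L ^ 2, [A, B])`, and
this vanishes because `[A, B]` is skewsymmetric. -/
theorem loopSkl_eq_sklPolar {L A B : Loop n} (hL : L ∈ symmElts n) (hA : A ∈ symmElts n)
    (hB : B ∈ symmElts n) : loopSkl L A B = sklPolar L L A B := by
  rw [mem_symmElts] at hL hA hB
  have h1 := rMatrix_eq_of_symm (n := n) (L := jordan L A)
    (by rw [mem_symmElts, involution_jordan, hL, hA])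
  have h2 := rMatrix_eq_of_symm (n := n) (L := jordan L B)
    (by rw [mem_symmElts, involution_jordan, hL, hB])
  have h3 := trCoeff_lie_eq_zero (L := L * L) (by rw [involution_mul, hL]) hA hB
  rw [loopSkl, loopInner_eq, h1, h2, sklPolar_eq_jordan]
  generalize signPart n (jordan L A) = p
  generalize signPart n (jordan L B) = q
  have rot (x y z : Loop n) : trCoeff 0 (x * y * z) = trCoeff 0 (y * z * x) := by
    rw [mul_assoc, trCoeff_mul_comm]
  have rot' (x y : Loop n) : trCoeff 0 (L * x * y * L) = trCoeff 0 (L * L * x * y) := by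
    rw [trCoeff_mul_comm]; simp only [← mul_assoc]
  simp only [jordan, Ring.lie_def, mul_add, add_mul, mul_sub, sub_mul, map_add, map_sub, smul_add,
    map_smul, smul_mul_assoc, mul_smul_comm, smul_eq_mul, ← mul_assoc] at h3 ⊢
  have e1 := rot L p B
  have e2 := rot L B p
  have e3 := rot L A q
  have e4 := rot L q A
  have e5 := rot B p L
  have e6 := rot A q L
  have e7 := rot' A B
  have e8 := rot' B A
  have e9 : trCoeff 0 (L * A * L * B) = trCoeff 0 (L * B * L * A) := by
    rw [mul_assoc (L * A), trCoeff_mul_comm, ← mul_assoc]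
  linarith

/-! ### Reduction to the phase space -/

theorem loopSkl_skew (L A B : Loop n) : loopSkl L A B = -loopSkl L B A := by
  rw [loopSkl, loopSkl, loopInner_eq, loopInner_eq, ← map_neg, ← mul_neg]
  congr 2
  simp only [Ring.lie_def]
  abel

theorem half_sub_rMatrix_mem (X : Loop n) :
    (1 / 2 : ℝ) • X - rMatrix n X ∈ supp n (Set.Iic 0) := by
  intro i j m h
  simp only [Set.mem_Iic, not_le] at h
  simp only [rMatrix_eq, Matrix.sub_apply, AddMonoidAlgebra.coeff_sub, Finsupp.sub_apply,
    involution_coeff, gradedPart_coeff, deg_neg, Matrix.smul_apply, AddMonoidAlgebra.coeff_smul,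
    Finsupp.smul_apply, smul_eq_mul]
  rw [if_pos (Set.mem_Ioi.2 h), if_neg (by simp only [Set.mem_Ioi]; omega)]
  ring

/-- A skewsymmetric element is determined by its negative part. -/
theorem gradedPart_neg_sub_involution {U : Loop n} (hU : involution U = -U) :
    gradedPart (Set.Iio 0) U - involution (gradedPart (Set.Iio 0) U) = U := by
  have h1 : involution (gradedPart (Set.Iio 0) U) = -gradedPart (Set.Ioi 0) U := by
    have := gradedPart_involution (Set.Ioi 0) U
    rw [hU, map_neg] at this
    rw [this]
    simp
  have h2 : gradedPart {0} U = 0 := by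
    ext i j m
    rw [gradedPart_coeff]
    split_ifs with h
    · obtain ⟨rfl, rfl⟩ := deg_eq_zero h
      have := involution_coeff U i i 0
      rw [hU] at this
      simp only [Matrix.neg_apply, AddMonoidAlgebra.coeff_neg, Finsupp.neg_apply, neg_zero] at this
      simpa using (by linarith : (U i i).coeff 0 = 0)
    · simp
  conv_rhs => rw [← gradedPart_add U, h2]
  rw [h1]
  abel

theorem trCoeff_positive_mul (X Y : Loop n) :
    trCoeff 0 (gradedPart (Set.Ioi 0) X * Y) = trCoeff 0 (X * gradedPart (Set.Iio 0) Y) := by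
  have h {D₁ D₂ D : Set ℤ} (hD : ∀ d₁ ∈ D₁, ∀ d₂ ∈ D₂, d₁ + d₂ ∈ D) (h0 : (0 : ℤ) ∉ D) :
      trCoeff 0 (gradedPart D₁ X * gradedPart D₂ Y) = 0 :=
    trCoeff_eq_zero h0 (mul_mem_supp hD (gradedPart_mem _ _) (gradedPart_mem _ _))
  have h1 := h (D₁ := Set.Ioi 0) (D₂ := Set.Ioi 0) (D := Set.Ioi 0)
    (by intro a ha b hb; simp only [Set.mem_Ioi] at *; omega) (by simp)
  have h2 := h (D₁ := Set.Iio 0) (D₂ := Set.Iio 0) (D := Set.Iio 0)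
    (by intro a ha b hb; simp only [Set.mem_Iio] at *; omega) (by simp)
  have h3 := h (D₁ := Set.Ioi 0) (D₂ := {0}) (D := Set.Ioi 0)
    (by intro a ha b hb; simp only [Set.mem_Ioi, Set.mem_singleton_iff] at *; omega) (by simp)
  have h6 := h (D₁ := {0}) (D₂ := Set.Iio 0) (D := Set.Iio 0)
    (by intro a ha b hb; simp only [Set.mem_Iio, Set.mem_singleton_iff] at *; omega) (by simp)
  conv_lhs => rw [← gradedPart_add Y]
  conv_rhs => rw [← gradedPart_add X]
  simp only [mul_add, add_mul, map_add, h1, h2, h3, h6]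
  ring

/-- At a point of the phase space the Hamiltonian vectors of the Sklyanin tensor are tangent to the
phase space. -/
theorem exists_loopSkl_eq {L : Loop n} (hL : L ∈ phaseSpace n) (B : Loop n) :
    ∃ W ∈ phaseSpace n, ∀ A, loopSkl L A B = trCoeff 0 (A * W) := by
  obtain ⟨hs, hd⟩ := mem_phaseSpace.1 hL
  obtain ⟨K, hK⟩ : ∃ K, K = B * L - L * B := ⟨_, rfl⟩
  have hU : involution (K - involution K) = -(K - involution K) := by
    rw [map_sub, involution_involution, neg_sub]
  obtain ⟨N, hN⟩ : ∃ N, N = gradedPart (Set.Iio 0) (K - involution K) := ⟨_, rfl⟩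
  have hN' : N - involution N = K - involution K :=
    hN ▸ gradedPart_neg_sub_involution hU
  -- `N - K / 2` is the image of `K` under the adjoint of `R`
  refine ⟨jordan L (N - (1 / 2 : ℝ) • K) + (rMatrix n (jordan L B) * L - L * rMatrix n (jordan L B)),
    mem_phaseSpace.2 ⟨?_, ?_⟩, fun A => ?_⟩
  · have hiN : involution N = N - K + involution K := by
      rw [sub_add, ← hN', sub_sub_cancel]
    have hiK : involution K = L * involution B - involution B * L := by
      rw [hK, map_sub, involution_mul, involution_mul, hs]
    rw [map_add, map_sub, involution_mul, involution_mul, involution_jordan, hs, map_sub, map_smul,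
      hiN, rMatrix_eq, map_sub, map_sub, involution_involution, map_smul, involution_jordan, hs, hiK]
    generalize gradedPart (Set.Ioi 0) (jordan L B) = P
    generalize involution P = P'
    generalize involution B = B'
    rw [hK]
    simp only [jordan, mul_add, add_mul, mul_sub, sub_mul, smul_add, smul_sub, mul_smul_comm,
      smul_mul_assoc, smul_smul, ← mul_assoc]
    module
  · have e : jordan L (N - (1 / 2 : ℝ) • K)
        + (rMatrix n (jordan L B) * L - L * rMatrix n (jordan L B)) = (1 / 2 : ℝ) • (L * N + N * L)
        + (L * ((1 / 2 : ℝ) • jordan L B - rMatrix n (jordan L B))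
          - ((1 / 2 : ℝ) • jordan L B - rMatrix n (jordan L B)) * L) := by
      generalize rMatrix n (jordan L B) = X
      rw [hK]
      simp only [jordan, mul_add, add_mul, mul_sub, sub_mul, smul_add, smul_sub, mul_smul_comm,
        smul_mul_assoc, smul_smul, ← mul_assoc]
      module
    have h0 := half_sub_rMatrix_mem (jordan L B)
    have hN0 : N ∈ supp n (Set.Iic 0) :=
      hN ▸ supp_mono Set.Iio_subset_Iic_self (gradedPart_mem (Set.Iio 0) _)
    have hl {X : Loop n} (hX : X ∈ supp n (Set.Iic 0)) :
        L * X ∈ supp n (Set.Iic ((n : ℤ) - 1)) ∧ X * L ∈ supp n (Set.Iic ((n : ℤ) - 1)) := by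
      constructor
      · refine mul_mem_supp ?_ hd hX
        intro a ha b hb; simp only [Set.mem_Iic] at *; omega
      · refine mul_mem_supp ?_ hX hd
        intro a ha b hb; simp only [Set.mem_Iic] at *; omega
    rw [e]
    exact add_mem (Submodule.smul_mem _ _ (add_mem (hl hN0).1 (hl hN0).2))
      (sub_mem (hl h0).1 (hl h0).2)
  · have h1 : trCoeff 0 (rMatrix n (jordan L A) * K) =
        trCoeff 0 (jordan L A * (N - (1 / 2 : ℝ) • K)) := by
      have h2 : trCoeff 0 (involution (gradedPart (Set.Ioi 0) (jordan L A)) * K) =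
          trCoeff 0 (gradedPart (Set.Ioi 0) (jordan L A) * involution K) := by
        rw [← neg_zero, ← trCoeff_involution, neg_zero, involution_mul, involution_involution,
          trCoeff_mul_comm]
      rw [rMatrix_eq, sub_mul, sub_mul, map_sub, map_sub, h2, ← map_sub, ← mul_sub,
        trCoeff_positive_mul, ← hN, mul_sub, map_sub, smul_mul_assoc, mul_smul_comm]
    rw [loopSkl, loopInner_eq]
    have h3 (X Y : Loop n) : trCoeff 0 (L * (X * Y)) = trCoeff 0 (X * (Y * L)) := by
      rw [trCoeff_mul_comm, mul_assoc]
    have h4 (X Y : Loop n) : trCoeff 0 (L * (X * Y)) = trCoeff 0 (Y * (L * X)) := by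
      rw [← mul_assoc, trCoeff_mul_comm]
    have h5 (Y : Loop n) : trCoeff 0 (jordan L A * Y) = trCoeff 0 (A * jordan L Y) := by
      simp only [jordan, smul_mul_assoc, mul_smul_comm, map_smul, add_mul, mul_add, map_add]
      rw [mul_assoc, trCoeff_mul_comm 0 L, mul_assoc, mul_assoc, add_comm]
    rw [mul_add A, map_add, ← h5, ← h1]
    generalize rMatrix n (jordan L A) = X
    generalize rMatrix n (jordan L B) = Y
    simp only [Ring.lie_def, hK, mul_add, mul_sub, map_add, map_sub]
    rw [h3 X B, h4 B X, h3 A Y, h4 Y A]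

theorem loopSkl_congr_left {L A A' : Loop n} (hL : L ∈ phaseSpace n)
    (h : ∀ M : phaseSpace n, loopInner A M = loopInner A' M) (B : Loop n) :
    loopSkl L A B = loopSkl L A' B := by
  obtain ⟨W, hW, e⟩ := exists_loopSkl_eq hL B
  rw [e, e, ← loopInner_eq, ← loopInner_eq]
  exact h ⟨W, hW⟩

theorem one_mem_phaseSpace : (1 : Loop n) ∈ phaseSpace n := by
  refine mem_phaseSpace.2 ⟨?_, fun i j m h => ?_⟩
  · rw [involution_eq, Matrix.transpose_one, Matrix.map_one _ (map_zero _) (map_one _)]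
  · rw [Matrix.one_apply]
    split_ifs with hij
    · rw [AddMonoidAlgebra.one_def, AddMonoidAlgebra.coeff_single]
      refine Finsupp.single_eq_of_ne ?_
      rintro rfl
      subst hij
      have : 0 < n := i.pos
      refine h ?_
      simp [deg]
      omega
    · rfl

/-- The Semenov-Tian-Shansky tensor is the increment of the Sklyanin tensor under the shift of the
base point by the unit element. -/
theorem loopSem_eq (L A B : Loop n) : loopSem L A B = loopSkl (L + 1) A B - loopSkl L A B := by
  have h (X : Loop n) : jordan (L + 1) X = jordan L X + X := by
    simp only [jordan, add_mul, mul_add, one_mul, mul_one, smul_add]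
    module
  simp only [loopSem, loopSkl, h, loopInner_eq, map_add, Ring.lie_def, add_mul, one_mul, mul_add,
    map_sub, mul_sub]
  simp only [trCoeff_mul_comm 0 A, trCoeff_mul_comm 0 B]
  ring

theorem loopSem_skew (L A B : Loop n) : loopSem L A B = -loopSem L B A := by
  rw [loopSem_eq, loopSem_eq, loopSkl_skew, loopSkl_skew L]
  ring

theorem loopSem_congr_left {L A A' : Loop n} (hL : L ∈ phaseSpace n)
    (h : ∀ M : phaseSpace n, loopInner A M = loopInner A' M) (B : Loop n) :
    loopSem L A B = loopSem L A' B := by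
  rw [loopSem_eq, loopSem_eq, loopSkl_congr_left hL h,
    loopSkl_congr_left (add_mem hL one_mem_phaseSpace) h]

/-! ### The phase space as a space of matrices -/

theorem coeff_mul_eq_sum (p q : ℝ[T;T⁻¹]) (s : Finset ℤ) (hp : ∀ i ∉ s, p.coeff i = 0) (m : ℤ) :
    (p * q).coeff m = ∑ i ∈ s, p.coeff i * q.coeff (m - i) := by
  rw [AddMonoidAlgebra.coeff_mul, Finsupp.sum_of_support_subset (s := s)]
  · refine Finset.sum_congr rfl fun i _ => ?_
    have h (k : ℤ) : i + k = m ↔ k = m - i := by constructor <;> intro h <;> omega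
    simp only [h]
    rw [Finsupp.sum_ite_eq']
    split_ifs with h'
    · rfl
    · rw [Finsupp.notMem_support_iff.1 h', mul_zero]
  · intro i hi
    by_contra h
    exact Finsupp.mem_support_iff.1 hi (hp i h)
  · intro i _
    simp

theorem loopCoeff_mul (X Y : Loop n) (s : Finset ℤ) (hX : ∀ i ∉ s, loopCoeff i X = 0) (m : ℤ) :
    loopCoeff m (X * Y) = ∑ i ∈ s, loopCoeff i X * loopCoeff (m - i) Y := by
  ext a b
  simp only [loopCoeff, LinearMap.coe_mk, AddHom.coe_mk, Matrix.of_apply, Matrix.mul_apply,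
    AddMonoidAlgebra.coeff_sum, Finsupp.finsetSum_apply, Matrix.sum_apply]
  rw [Finset.sum_comm]
  refine Finset.sum_congr rfl fun k _ => coeff_mul_eq_sum _ _ _ (fun i hi => ?_) _
  exact congrFun (congrFun (hX i hi) a) k

/-- The coefficient of `λ` in the loop of a matrix. -/
def low (L : Gl n) : Gl n := lowerPart (altPart L)

theorem loopCoeff_toLoop (L : Gl n) (m : ℤ) : loopCoeff m (toLoop L) =
    if m = 0 then symPart L else if m = 1 then low L else if m = -1 then (low L).transpose else 0 := by
  ext i j
  simp only [loopCoeff, LinearMap.coe_mk, AddHom.coe_mk, Matrix.of_apply, toLoop_coeff, low]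
  by_cases h0 : m = 0
  · subst h0; simp
  by_cases h1 : m = 1
  · subst h1; simp
  by_cases h2 : m = -1
  · subst h2; simp
  simp [h0, h1, h2]

theorem symPart_transpose (L : Gl n) : (symPart L).transpose = symPart L := by
  ext i j
  simp only [Matrix.transpose_apply, symPart_apply]; ring

theorem altPart_transpose (L : Gl n) : (altPart L).transpose = -altPart L := by
  ext i j
  simp only [Matrix.transpose_apply, altPart_apply, Matrix.neg_apply]; ring

theorem symPart_add_altPart (L : Gl n) : symPart L + altPart L = L := by
  ext i j
  simp only [Matrix.add_apply, altPart_apply, symPart_apply]; ring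

theorem altPart_eq_low (L : Gl n) : altPart L = low L - (low L).transpose := by
  ext i j
  simp only [low, Matrix.sub_apply, Matrix.transpose_apply, lowerPart_apply, altPart_apply]
  rcases lt_trichotomy i j with h | h | h
  · simp [h, h.not_gt]; ring
  · subst h; simp
  · simp [h, h.not_gt]

/-- Strictly lower triangular matrices. -/
def IsLower (X : Gl n) : Prop := ∀ i j, i ≤ j → X i j = 0

theorem isLower_low (L : Gl n) : IsLower (low L) := fun i j h => by
  rw [low, lowerPart_apply, if_neg h.not_gt]

theorem IsLower.trace_mul {X Y : Gl n} (hX : IsLower X) (hY : IsLower Y) :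
    Matrix.trace (X * Y) = 0 := by
  refine Finset.sum_eq_zero fun i _ => ?_
  rw [Matrix.diag_apply, Matrix.mul_apply]
  refine Finset.sum_eq_zero fun k _ => ?_
  rcases le_total i k with h | h
  · rw [hX i k h, zero_mul]
  · rw [hY k i h, mul_zero]

theorem trace_mul_transpose_comm (X Y : Gl n) :
    Matrix.trace (X.transpose * Y.transpose) = Matrix.trace (X * Y) := by
  rw [← Matrix.transpose_mul, Matrix.trace_transpose, Matrix.trace_mul_comm]

theorem loopCoeff_toLoop_eq_zero (L : Gl n) {m : ℤ} (hm : m ∉ ({-1, 0, 1} : Finset ℤ)) :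
    loopCoeff m (toLoop L) = 0 := by
  simp only [Finset.mem_insert, Finset.mem_singleton, not_or] at hm
  rw [loopCoeff_toLoop, if_neg hm.2.1, if_neg hm.2.2, if_neg hm.1]

/-- `Φ` is an isometry. -/
theorem loopInner_toLoop (L M : Gl n) : loopInner (toLoop L) (toLoop M) = glInner L M := by
  rw [loopInner, loopCoeff_mul _ _ {-1, 0, 1} fun i hi => loopCoeff_toLoop_eq_zero L hi]
  simp only [loopCoeff_toLoop]
  norm_num
  rw [glInner]
  conv_rhs => rw [← symPart_add_altPart L, ← symPart_add_altPart M, Matrix.transpose_add,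
    symPart_transpose, altPart_transpose]
  simp only [altPart_eq_low, mul_add, add_mul, mul_sub, sub_mul, Matrix.trace_add, Matrix.trace_sub,
    neg_sub]
  have h1 := (isLower_low L).trace_mul (isLower_low M)
  have h2 := trace_mul_transpose_comm (low L) (low M)
  have h3 := trace_mul_transpose_comm (symPart L) (low M)
  have h4 := trace_mul_transpose_comm (low L) (symPart M)
  rw [symPart_transpose] at h3 h4
  linarith

/-- The loop of a matrix, as a linear map. -/
def toLoopLin (n : ℕ) : Gl n →ₗ[ℝ] Loop n := (phaseSpace n).subtype ∘ₗ (Phi n).symm.toLinearMap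

theorem coe_Phi_symm (L : Gl n) : (((Phi n).symm L : phaseSpace n) : Loop n) = toLoop L := rfl

theorem toLoop_Phi (L : phaseSpace n) : toLoop (Phi n L) = L := by
  rw [← coe_Phi_symm, LinearEquiv.symm_apply_apply]

theorem glInner_Phi (L : phaseSpace n) (M : Gl n) :
    glInner (Phi n L) M = loopInner L (toLoop M) := by
  rw [← loopInner_toLoop, toLoop_Phi]

theorem toLoop_one : toLoop (1 : Gl n) = 1 := by
  have : (1 : Gl n) = Phi n ⟨1, one_mem_phaseSpace⟩ := by
    ext i j
    have h : (1 : ℝ[T;T⁻¹]).coeff 1 = 0 := by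
      rw [AddMonoidAlgebra.one_def, AddMonoidAlgebra.coeff_single]; exact Finsupp.single_eq_of_ne one_ne_zero
    have h0 : (1 : ℝ[T;T⁻¹]).coeff 0 = 1 := by
      rw [AddMonoidAlgebra.one_def, AddMonoidAlgebra.coeff_single]; simp
    simp only [Phi, loopCoeff, LinearEquiv.coe_mk, LinearMap.coe_mk, AddHom.coe_mk, Matrix.sub_apply,
      Matrix.add_apply, Matrix.of_apply, Matrix.transpose_apply, Matrix.one_apply]
    by_cases hij : i = j
    · subst hij; simp [h, h0]
    · simp [hij, Ne.symm hij]
  rw [this, toLoop_Phi]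

theorem loopInner_toLoop_grad {f : Gl n → ℝ} {L M : phaseSpace n} :
    loopInner (toLoop (grad f (Phi n L))) M = fderiv ℝ f (Phi n L) (Phi n M) := by
  rw [← glInner_grad, ← loopInner_toLoop, toLoop_Phi]

theorem isReduction_carried {P : Loop n → Loop n → Loop n → ℝ} (skew : ∀ L A B, P L A B = -P L B A)
    (congr_left : ∀ {L A A' : Loop n}, L ∈ phaseSpace n →
      (∀ M : phaseSpace n, loopInner A M = loopInner A' M) → ∀ B, P L A B = P L A' B) :
    IsReduction P (carried P) := by
  intro f g _ _ L A B hA hB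
  have hA' : ∀ M : phaseSpace n, loopInner (toLoop (grad f (Phi n L))) M = loopInner A M :=
    fun M => by rw [hA, loopInner_toLoop_grad]
  have hB' : ∀ M : phaseSpace n, loopInner (toLoop (grad g (Phi n L))) M = loopInner B M :=
    fun M => by rw [hB, loopInner_toLoop_grad]
  rw [carried, coe_Phi_symm, coe_Phi_symm, coe_Phi_symm, toLoop_Phi, congr_left L.2 hA', skew,
    congr_left L.2 hB', ← skew]

theorem isReduction_sem : IsReduction loopSem (semBracket n) :=
  isReduction_carried loopSem_skew loopSem_congr_left

theorem isReduction_skl : IsReduction loopSkl (sklBracket n) :=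
  isReduction_carried loopSkl_skew loopSkl_congr_left

/-! ### The Sklyanin and the Semenov-Tian-Shansky bivector -/

theorem toLoop_mem_symmElts (L : Gl n) : toLoop L ∈ symmElts n := (toLoop_mem L).1

theorem toLoop_add (L M : Gl n) : toLoop (L + M) = toLoop L + toLoop M := map_add (toLoopLin n) L M

theorem toLoop_smul (c : ℝ) (L : Gl n) : toLoop (c • L) = c • toLoop L := map_smul (toLoopLin n) c L

/-- The bivector field of the Sklyanin bracket. Its values are given by the tensor of the classical
r-matrix, which agrees with `loopSkl` on the loops of matrices. -/
def sklBivector (n : ℕ) : Bivector n where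
  form L := LinearMap.mk₂ ℝ (fun A B => sklPolar (toLoop L) (toLoop L) (toLoop A) (toLoop B))
    (fun A A' B => by simp only [sklPolar, toLoop_add, add_mul, mul_add, map_add]; ring)
    (fun c A B => by
      simp only [sklPolar, toLoop_smul, smul_mul_assoc, mul_smul_comm, map_smul, smul_eq_mul]; ring)
    (fun A B B' => by simp only [sklPolar, toLoop_add, add_mul, mul_add, map_add]; ring)
    (fun c A B => by
      simp only [sklPolar, toLoop_smul, smul_mul_assoc, mul_smul_comm, map_smul, smul_eq_mul]; ring)
  lin _ _ := 0
  quad A B := LinearMap.mk₂ ℝ (fun L M => sklPolar (toLoop L) (toLoop M) (toLoop A) (toLoop B))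
    (fun A A' B => by simp only [sklPolar, toLoop_add, add_mul, mul_add, map_add]; ring)
    (fun c A B => by
      simp only [sklPolar, toLoop_smul, smul_mul_assoc, mul_smul_comm, map_smul, smul_eq_mul]; ring)
    (fun A B B' => by simp only [sklPolar, toLoop_add, add_mul, mul_add, map_add]; ring)
    (fun c A B => by
      simp only [sklPolar, toLoop_smul, smul_mul_assoc, mul_smul_comm, map_smul, smul_eq_mul]; ring)
  ham L A := Phi n ⟨sklHam (toLoop L) (toLoop A), sklHam_mem (toLoop_mem L) (toLoop_mem_symmElts A)⟩
  form_eq L A B := by simp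
  skew L A B := by simp [sklPolar_skew _ (toLoop A)]
  ham_eq L A B := by rw [glInner_Phi, loopInner_eq, ← sklPolar_self]; rfl

theorem sklBivector_form (L A B : Gl n) :
    (sklBivector n).form L A B = loopSkl (toLoop L) (toLoop A) (toLoop B) :=
  (loopSkl_eq_sklPolar (toLoop_mem_symmElts L) (toLoop_mem_symmElts A)
    (toLoop_mem_symmElts B)).symm

theorem sklBracket_eq : sklBracket n = (sklBivector n).bracket := by
  funext f g L
  exact (sklBivector_form _ _ _).symm

theorem isPoisson_skl : IsPoisson (sklBracket n) := by
  rw [sklBracket_eq]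
  refine (sklBivector n).isPoisson_bracket fun L A B C => ?_
  have := sklPolar_jacobi (toLoop L) (toLoop A) (toLoop B) (toLoop C)
  simpa [Bivector.deriv, sklBivector, toLoop_Phi] using this

/-- The bivector field of the Semenov-Tian-Shansky bracket. -/
def semBivector (n : ℕ) : Bivector n where
  form L := LinearMap.mk₂ ℝ (fun A B => loopSem (toLoop L) (toLoop A) (toLoop B))
    (fun A A' B => by
      simp only [loopSem, loopInner_eq, toLoop_add, map_add, map_sub, Ring.lie_def, add_mul, mul_add,
        mul_sub]
      ring)
    (fun c A B => by
      simp only [loopSem, loopInner_eq, toLoop_smul, map_smul, Ring.lie_def, map_add, map_sub, mul_add,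
        mul_sub, mul_smul_comm, smul_mul_assoc, smul_eq_mul])
    (fun A B B' => by
      simp only [loopSem, loopInner_eq, toLoop_add, map_add, map_sub, Ring.lie_def, add_mul, mul_add,
        mul_sub]
      ring)
    (fun c A B => by
      simp only [loopSem, loopInner_eq, toLoop_smul, map_smul, Ring.lie_def, map_add, map_sub, mul_add,
        mul_sub, mul_smul_comm, smul_mul_assoc, smul_eq_mul])
  lin A B :=
    { toFun := fun L => loopSem (toLoop L) (toLoop A) (toLoop B)
      map_add' := fun L M => by simp only [loopSem, loopInner_eq, toLoop_add, add_mul, map_add]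
      map_smul' := fun c L => by
        simp only [loopSem, loopInner_eq, toLoop_smul, smul_mul_assoc, map_smul, RingHom.id_apply] }
  quad _ _ := 0
  -- the tensor is an increment of the Sklyanin tensor, and so are the Hamiltonian vectors
  ham L A := (sklBivector n).ham (L + 1) A - (sklBivector n).ham L A
  form_eq L A B := by simp
  skew L A B := by simp [loopSem_skew _ (toLoop A)]
  ham_eq L A B := by
    have h : glInner ((sklBivector n).ham (L + 1) A - (sklBivector n).ham L A) B =
        glInner ((sklBivector n).ham (L + 1) A) B - glInner ((sklBivector n).ham L A) B := by
      simp only [glInner, sub_mul, Matrix.trace_sub]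
    rw [h, ← (sklBivector n).ham_eq, ← (sklBivector n).ham_eq, sklBivector_form, sklBivector_form,
      toLoop_add, toLoop_one, ← loopSem_eq]
    rfl

theorem semBracket_eq : semBracket n = (semBivector n).bracket := rfl

/-- The Lie derivative of a bracket along the constant vector field `1`. -/
theorem lieDeriv_one (P : Bivector n) {f g : Gl n → ℝ} (hf : Smooth f) (hg : Smooth g) (L : Gl n) :
    lieDeriv (fun _ => 1) P.bracket f g L = P.deriv L 1 (grad f L) (grad g L) := by
  rw [P.lieDeriv_bracket (X := fun _ => 1) (DX := fun _ _ => 0) contDiff_const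
    (fun L W => by rw [fderiv_const_apply]; rfl) hf hg, Bivector.lie]
  simp [glInner]

theorem semBracket_eq_lieDeriv {f g : Gl n → ℝ} (hf : Smooth f) (hg : Smooth g) :
    semBracket n f g = lieDeriv (fun _ => 1) (sklBracket n) f g := by
  ext L
  rw [sklBracket_eq, lieDeriv_one _ hf hg]
  have h (A B : Gl n) : (sklBivector n).deriv L 1 A B = loopSem (toLoop L) (toLoop A) (toLoop B) := by
    have h1 : (sklBivector n).form 1 A B = 0 := by
      simp [sklBivector, toLoop_one, sklPolar]
    rw [loopSem_eq, ← toLoop_one, ← toLoop_add, ← sklBivector_form, ← sklBivector_form]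
    rw [Bivector.form_eq] at h1 ⊢
    have h0 : (sklBivector n).lin A B = 0 := rfl
    rw [Bivector.form_eq, Bivector.deriv]
    simp only [map_add, LinearMap.add_apply, h0, LinearMap.zero_apply] at h1 ⊢
    linarith
  exact (h _ _).symm

theorem lieDeriv_one_semBracket {f g : Gl n → ℝ} (hf : Smooth f) (hg : Smooth g) :
    lieDeriv (fun _ => 1) (semBracket n) f g = 0 := by
  ext L
  rw [semBracket_eq, lieDeriv_one _ hf hg]
  have h1 (X Y : Loop n) : trCoeff 0 (X * Y - Y * X) = 0 := by
    rw [map_sub, trCoeff_mul_comm, sub_self]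
  simp [Bivector.deriv, semBivector, loopSem, toLoop_one, loopInner_eq, Ring.lie_def, h1]

theorem isPoisson_sem : IsPoisson (semBracket n) :=
  (semBivector n).isPoisson_of_jacobi fun _ _ _ =>
    jacobi_of_lieDeriv contDiff_const isPoisson_skl (fun _ _ => (semBivector n).smooth_bracket)
      (fun _ _ _ _ => (semBivector n).bracket_add_right) (fun _ _ => semBracket_eq_lieDeriv)
      (fun _ _ => lieDeriv_one_semBracket)

theorem mixed_skl_sem : Mixed (sklBracket n) (semBracket n) :=
  mixed_of_lieDeriv contDiff_const isPoisson_skl (fun _ _ => (semBivector n).smooth_bracket)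
    (fun _ _ => semBracket_eq_lieDeriv)

/-! ### Evaluation of loops at the imaginary unit -/

/-- The value of a Laurent polynomial at the imaginary unit. -/
def evalI : ℝ[T;T⁻¹] →ₐ[ℝ] ℂ :=
  AddMonoidAlgebra.lift ℝ ℂ ℤ
    ((Units.coeHom ℂ).comp (zpowersHom ℂˣ (Units.mk0 Complex.I Complex.I_ne_zero)))

theorem evalI_apply (p : ℝ[T;T⁻¹]) : evalI p = p.coeff.sum fun m c => (c : ℂ) * Complex.I ^ m := by
  rw [evalI, AddMonoidAlgebra.lift_apply]
  simp

/-- The value of a loop at the imaginary unit. -/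
def loopEvalI (n : ℕ) : Loop n →ₐ[ℝ] Matrix (Fin n) (Fin n) ℂ := evalI.mapMatrix

/-- The powers of `λ` in `X` are between `-N` and `N`. -/
def Bounded (N : ℤ) (X : Loop n) : Prop := ∀ m ∉ Finset.Icc (-N) N, loopCoeff m X = 0

theorem Bounded.mul {N N' d : ℤ} (h : N + N' = d) {X Y : Loop n} (hX : Bounded N X)
    (hY : Bounded N' Y) : Bounded d (X * Y) := by
  intro m hm
  rw [loopCoeff_mul X Y _ hX]
  refine Finset.sum_eq_zero fun i hi => ?_
  rw [hY, mul_zero]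
  simp only [Finset.mem_Icc] at *
  omega

theorem Bounded.add {N : ℤ} {X Y : Loop n} (hX : Bounded N X) (hY : Bounded N Y) :
    Bounded N (X + Y) := fun m hm => by rw [map_add, hX m hm, hY m hm, add_zero]

theorem Bounded.sub {N : ℤ} {X Y : Loop n} (hX : Bounded N X) (hY : Bounded N Y) :
    Bounded N (X - Y) := fun m hm => by rw [map_sub, hX m hm, hY m hm, sub_zero]

theorem Bounded.smul {N : ℤ} {X : Loop n} (c : ℝ) (hX : Bounded N X) :
    Bounded N (c • X) := fun m hm => by rw [map_smul, hX m hm, smul_zero]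

theorem Bounded.jordan {N N' d : ℤ} (h : N + N' = d) {X Y : Loop n} (hX : Bounded N X)
    (hY : Bounded N' Y) : Bounded d (Kupershmidt.jordan X Y) :=
  ((hX.mul h hY).add (hY.mul ((add_comm N' N).trans h) hX)).smul _

theorem bounded_toLoop (L : Gl n) : Bounded 1 (toLoop L) := fun _ hm =>
  loopCoeff_toLoop_eq_zero L hm

theorem loopEvalI_apply {N : ℤ} {X : Loop n} (hX : Bounded N X) (i j : Fin n) :
    loopEvalI n X i j = ∑ m ∈ Finset.Icc (-N) N, (loopCoeff m X i j : ℂ) * Complex.I ^ m := by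
  have : loopEvalI n X i j = evalI (X i j) := rfl
  rw [this, evalI_apply, Finsupp.sum_of_support_subset (s := Finset.Icc (-N) N)]
  · rfl
  · intro m hm
    by_contra h
    exact Finsupp.mem_support_iff.1 hm (congrFun (congrFun (hX m h) i) j)
  · intro i _
    simp

/-- The real part of a complex matrix. -/
def rePart (X : Matrix (Fin n) (Fin n) ℂ) : Gl n := X.map Complex.re

/-- The imaginary part of a complex matrix. -/
def imPart (X : Matrix (Fin n) (Fin n) ℂ) : Gl n := X.map Complex.im

theorem rePart_loopEvalI {X : Loop n} (hX : Bounded 2 X) :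
    rePart (loopEvalI n X) = loopCoeff 0 X - loopCoeff 2 X - loopCoeff (-2) X := by
  ext i j
  rw [rePart, Matrix.map_apply, loopEvalI_apply hX,
    show Finset.Icc (-2 : ℤ) 2 = {-2, -1, 0, 1, 2} from rfl]
  simp [zpow_ofNat]
  ring

theorem imPart_loopEvalI {X : Loop n} (hX : Bounded 3 X) :
    imPart (loopEvalI n X) =
      loopCoeff 1 X - loopCoeff (-1) X - loopCoeff 3 X + loopCoeff (-3) X := by
  ext i j
  rw [imPart, Matrix.map_apply, loopEvalI_apply hX,
    show Finset.Icc (-3 : ℤ) 3 = {-3, -2, -1, 0, 1, 2, 3} from rfl]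
  simp [zpow_ofNat]
  ring

theorem rePart_mul (X Y : Matrix (Fin n) (Fin n) ℂ) :
    rePart (X * Y) = rePart X * rePart Y - imPart X * imPart Y := by
  ext i j
  simp [rePart, imPart, Matrix.mul_apply]

theorem imPart_mul (X Y : Matrix (Fin n) (Fin n) ℂ) :
    imPart (X * Y) = rePart X * imPart Y + imPart X * rePart Y := by
  ext i j
  simp [rePart, imPart, Matrix.mul_apply, Finset.sum_add_distrib]

theorem rePart_I_smul (X : Matrix (Fin n) (Fin n) ℂ) : rePart (Complex.I • X) = -imPart X := by
  ext i j
  simp [rePart, imPart]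

theorem imPart_I_smul (X : Matrix (Fin n) (Fin n) ℂ) : imPart (Complex.I • X) = rePart X := by
  ext i j
  simp [rePart, imPart]

theorem rePart_add (X Y : Matrix (Fin n) (Fin n) ℂ) : rePart (X + Y) = rePart X + rePart Y := by
  ext i j; simp [rePart]

theorem imPart_add (X Y : Matrix (Fin n) (Fin n) ℂ) : imPart (X + Y) = imPart X + imPart Y := by
  ext i j; simp [imPart]

theorem rePart_sub (X Y : Matrix (Fin n) (Fin n) ℂ) : rePart (X - Y) = rePart X - rePart Y := by
  ext i j; simp [rePart]

theorem imPart_sub (X Y : Matrix (Fin n) (Fin n) ℂ) : imPart (X - Y) = imPart X - imPart Y := by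
  ext i j; simp [imPart]

theorem rePart_smul (c : ℝ) (X : Matrix (Fin n) (Fin n) ℂ) : rePart (c • X) = c • rePart X := by
  ext i j; simp [rePart]

theorem imPart_smul (c : ℝ) (X : Matrix (Fin n) (Fin n) ℂ) : imPart (c • X) = c • imPart X := by
  ext i j; simp [imPart]

theorem ext_rePart_imPart {X Y : Matrix (Fin n) (Fin n) ℂ} (h₁ : rePart X = rePart Y)
    (h₂ : imPart X = imPart Y) : X = Y := by
  ext i j
  exact Complex.ext (congrFun (congrFun h₁ i) j) (congrFun (congrFun h₂ i) j)

/-- The Hermitian matrix `L_S + i L_A`; it is the value at `i` of the loop of `L`. -/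
def herm (L : Gl n) : Matrix (Fin n) (Fin n) ℂ := loopEvalI n (toLoop L)

theorem rePart_herm (L : Gl n) : rePart (herm L) = symPart L := by
  rw [herm, rePart_loopEvalI fun m hm => bounded_toLoop L m (by simp only [Finset.mem_Icc] at *; omega)]
  simp [loopCoeff_toLoop]

theorem imPart_herm (L : Gl n) : imPart (herm L) = altPart L := by
  rw [herm, imPart_loopEvalI fun m hm => bounded_toLoop L m (by simp only [Finset.mem_Icc] at *; omega),
    altPart_eq_low]
  simp [loopCoeff_toLoop]

theorem herm_nsBracket (L M : Gl n) :
    herm (nsBracket L M) = Complex.I • (herm L * herm M - herm M * herm L) := by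
  apply ext_rePart_imPart
  · rw [rePart_I_smul, rePart_herm, imPart_sub, imPart_mul, imPart_mul]
    simp only [rePart_herm, imPart_herm]
    rw [symPart, nsBracket]
    simp only [Ring.lie_def, Matrix.transpose_sub, Matrix.transpose_mul, symPart_transpose,
      altPart_transpose, mul_neg, neg_mul, neg_neg]
    module
  · rw [imPart_I_smul, imPart_herm, rePart_sub, rePart_mul, rePart_mul]
    simp only [rePart_herm, imPart_herm]
    rw [altPart, nsBracket]
    simp only [Ring.lie_def, Matrix.transpose_sub, Matrix.transpose_mul, symPart_transpose,
      altPart_transpose, mul_neg, neg_mul, neg_neg]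
    module

theorem herm_odot (L M : Gl n) : herm (odot L M) = jordan (herm L) (herm M) := by
  apply ext_rePart_imPart
  · rw [jordan, rePart_smul, rePart_herm, rePart_add, rePart_mul, rePart_mul]
    simp only [rePart_herm, imPart_herm]
    rw [symPart, odot]
    simp only [jordan, Matrix.transpose_add, Matrix.transpose_sub, Matrix.transpose_smul,
      Matrix.transpose_mul, symPart_transpose, altPart_transpose, mul_neg, neg_mul, neg_neg]
    module
  · rw [jordan, imPart_smul, imPart_herm, imPart_add, imPart_mul, imPart_mul]
    simp only [rePart_herm, imPart_herm]
    rw [altPart, odot]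
    simp only [jordan, Matrix.transpose_add, Matrix.transpose_sub, Matrix.transpose_smul,
      Matrix.transpose_mul, symPart_transpose, altPart_transpose, mul_neg, neg_mul, neg_neg]
    module

/-- The real part of the trace. -/
def reTrace (n : ℕ) : Matrix (Fin n) (Fin n) ℂ →ₗ[ℝ] ℝ where
  toFun X := Matrix.trace (rePart X)
  map_add' X Y := by rw [rePart_add, Matrix.trace_add]
  map_smul' c X := by rw [rePart_smul, Matrix.trace_smul, RingHom.id_apply]

theorem reTrace_apply (X : Matrix (Fin n) (Fin n) ℂ) : reTrace n X = Matrix.trace (rePart X) := rfl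

theorem reTrace_mul_comm (X Y : Matrix (Fin n) (Fin n) ℂ) :
    reTrace n (X * Y) = reTrace n (Y * X) := by
  rw [reTrace_apply, reTrace_apply, rePart_mul, rePart_mul, Matrix.trace_sub, Matrix.trace_sub,
    Matrix.trace_mul_comm, Matrix.trace_mul_comm (imPart X)]

theorem glInner_eq_reTrace (L M : Gl n) : glInner L M = reTrace n (herm L * herm M) := by
  rw [reTrace_apply, rePart_mul]
  simp only [rePart_herm, imPart_herm]
  rw [glInner]
  conv_lhs => rw [← symPart_add_altPart L, ← symPart_add_altPart M]
  simp only [Matrix.transpose_add, symPart_transpose, altPart_transpose, mul_add, add_mul, mul_neg,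
    Matrix.trace_add, Matrix.trace_sub, Matrix.trace_neg]
  have h1 := trace_mul_transpose_comm (symPart L) (altPart M)
  have h2 := trace_mul_transpose_comm (altPart L) (symPart M)
  rw [symPart_transpose, altPart_transpose, mul_neg, Matrix.trace_neg] at h1
  rw [symPart_transpose, altPart_transpose, neg_mul, Matrix.trace_neg] at h2
  linarith

/-! ### The linear bracket -/

theorem glInner_nsBracket (L A B : Gl n) : glInner L (nsBracket A B) =
    reTrace n (Complex.I • (herm L * (herm A * herm B - herm B * herm A))) := by
  rw [glInner_eq_reTrace, herm_nsBracket, mul_smul_comm]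

theorem glInner_nsBracket_comm (L A B : Gl n) :
    glInner L (nsBracket A B) = glInner (nsBracket L A) B := by
  rw [glInner_nsBracket, glInner_eq_reTrace, herm_nsBracket, smul_mul_assoc, mul_sub, sub_mul,
    smul_sub, smul_sub, map_sub, map_sub, mul_assoc, ← smul_mul_assoc, ← smul_mul_assoc,
    ← smul_mul_assoc, ← smul_mul_assoc, ← mul_assoc _ (herm B), reTrace_mul_comm (_ * herm B)]
  simp only [mul_assoc, mul_smul_comm, smul_mul_assoc]

theorem symPart_add (L M : Gl n) : symPart (L + M) = symPart L + symPart M := by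
  simp only [symPart, Matrix.transpose_add]; module

theorem altPart_add (L M : Gl n) : altPart (L + M) = altPart L + altPart M := by
  simp only [altPart, Matrix.transpose_add]; module

theorem symPart_smul (c : ℝ) (L : Gl n) : symPart (c • L) = c • symPart L := by
  simp only [symPart, Matrix.transpose_smul]; module

theorem altPart_smul (c : ℝ) (L : Gl n) : altPart (c • L) = c • altPart L := by
  simp only [altPart, Matrix.transpose_smul]; module

theorem herm_add (L M : Gl n) : herm (L + M) = herm L + herm M := by
  rw [herm, toLoop_add, map_add]; rfl

theorem herm_smul (c : ℝ) (L : Gl n) : herm (c • L) = c • herm L := by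
  rw [herm, toLoop_smul, map_smul]; rfl

/-- The bivector field of the linear bracket. -/
def linBivector (n : ℕ) : Bivector n where
  form L := LinearMap.mk₂ ℝ (fun A B => glInner L (nsBracket A B))
    (fun A A' B => by
      simp only [glInner_nsBracket, herm_add, add_mul, mul_add, mul_sub, smul_add, smul_sub, map_add,
        map_sub]
      ring)
    (fun c A B => by
      simp only [glInner_nsBracket, herm_smul, smul_mul_assoc, mul_smul_comm, ← smul_sub,
        smul_comm Complex.I c, map_smul])
    (fun A B B' => by
      simp only [glInner_nsBracket, herm_add, add_mul, mul_add, mul_sub, smul_add, smul_sub, map_add,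
        map_sub]
      ring)
    (fun c A B => by
      simp only [glInner_nsBracket, herm_smul, smul_mul_assoc, mul_smul_comm, ← smul_sub,
        smul_comm Complex.I c, map_smul])
  lin A B :=
    { toFun := fun L => glInner L (nsBracket A B)
      map_add' := fun L M => by simp only [glInner, add_mul, Matrix.trace_add]
      map_smul' := fun c L => by
        simp only [glInner, smul_mul_assoc, Matrix.trace_smul, RingHom.id_apply] }
  quad _ _ := 0
  ham L A := nsBracket L A
  form_eq L A B := by simp; rfl
  skew L A B := by
    simp only [LinearMap.mk₂_apply, glInner_nsBracket]
    rw [← map_neg, ← smul_neg, ← mul_neg, neg_sub]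
  ham_eq L A B := glInner_nsBracket_comm L A B

theorem linBracket_eq : linBracket n = (linBivector n).bracket := rfl

theorem isPoisson_lin : IsPoisson (linBracket n) := by
  refine (linBivector n).isPoisson_bracket fun L A B C => ?_
  have h (A B C : Gl n) : (linBivector n).deriv L ((linBivector n).ham L A) B C =
      -reTrace n ((herm L * herm A - herm A * herm L) * (herm B * herm C - herm C * herm B)) := by
    have : (linBivector n).deriv L ((linBivector n).ham L A) B C =
        glInner (nsBracket L A) (nsBracket B C) := by
      simp [Bivector.deriv, linBivector]; rfl
    rw [this, glInner_eq_reTrace, herm_nsBracket, herm_nsBracket, smul_mul_assoc, mul_smul_comm,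
      smul_smul, Complex.I_mul_I, neg_one_smul, map_neg]
  rw [h, h, h]
  have rot (X Y Z : Matrix (Fin n) (Fin n) ℂ) :
      reTrace n (X * herm L * Y * Z) = reTrace n (herm L * Y * Z * X) := by
    rw [mul_assoc, mul_assoc, reTrace_mul_comm, ← mul_assoc]
  simp only [mul_sub, sub_mul, map_sub, ← mul_assoc, rot]
  ring

/-! ### The derivation of the loop algebra -/

/-- The derivation `λ d/dλ` of Laurent polynomials. -/
def euler : ℝ[T;T⁻¹] →ₗ[ℝ] ℝ[T;T⁻¹] where
  toFun p := AddMonoidAlgebra.ofCoeff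
    (Finsupp.onFinset p.coeff.support (fun m => (m : ℝ) * p.coeff m) fun m hm =>
      Finsupp.mem_support_iff.2 (right_ne_zero_of_mul hm))
  map_add' p q := by ext m; simp [mul_add]
  map_smul' c p := by ext m; simp; ring

theorem euler_coeff (p : ℝ[T;T⁻¹]) (m : ℤ) : (euler p).coeff m = m * p.coeff m := rfl

theorem euler_mul (p q : ℝ[T;T⁻¹]) : euler (p * q) = euler p * q + p * euler q := by
  ext m
  have h : ∀ i ∉ p.coeff.support, p.coeff i = 0 := fun i hi => Finsupp.notMem_support_iff.1 hi
  rw [AddMonoidAlgebra.coeff_add, Finsupp.add_apply, euler_coeff, coeff_mul_eq_sum p q _ h,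
    coeff_mul_eq_sum (euler p) q p.coeff.support (fun i hi => by rw [euler_coeff, h i hi, mul_zero]),
    coeff_mul_eq_sum p (euler q) _ h, Finset.mul_sum, ← Finset.sum_add_distrib]
  refine Finset.sum_congr rfl fun i _ => ?_
  rw [euler_coeff, euler_coeff]
  push_cast
  ring

/-- The derivation `λ d/dλ` of the loop algebra. -/
def loopEuler (n : ℕ) : Loop n →ₗ[ℝ] Loop n := euler.mapMatrix

theorem loopEuler_mul (X Y : Loop n) : loopEuler n (X * Y) = loopEuler n X * Y + X * loopEuler n Y := by
  ext1 i j
  have h (Z : Loop n) (i j : Fin n) : loopEuler n Z i j = euler (Z i j) := rfl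
  simp only [h, Matrix.mul_apply, Matrix.add_apply, map_sum, euler_mul, Finset.sum_add_distrib]

theorem loopCoeff_loopEuler (m : ℤ) (X : Loop n) :
    loopCoeff m (loopEuler n X) = (m : ℝ) • loopCoeff m X := rfl

theorem Bounded.loopEuler {N : ℤ} {X : Loop n} (hX : Bounded N X) :
    Bounded N (Kupershmidt.loopEuler n X) := fun m hm => by
  rw [loopCoeff_loopEuler, hX m hm, smul_zero]

/-- An identity between traces of words in `L`, `A`, `B` and one derivative of these; it uses only the
Leibniz rule. -/
theorem trace_loopEuler_identity (t : Loop n →ₗ[ℝ] ℝ) (ht : ∀ X Y, t (X * Y) = t (Y * X))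
    (L A B : Loop n) :
    t (loopEuler n L * (A * L * B - B * L * A)) =
      (1 / 2) * t (loopEuler n (jordan L A) * (L * B - B * L)
        - jordan L A * loopEuler n (L * B - B * L))
      - (1 / 2) * t (loopEuler n (jordan L B) * (L * A - A * L)
        - jordan L B * loopEuler n (L * A - A * L)) := by
  -- every word is rotated so that it begins with the differentiated letter
  have r1 (X Y Z W : Loop n) : t (X * loopEuler n W * Y * Z) = t (loopEuler n W * Y * Z * X) := by
    rw [mul_assoc, mul_assoc, ht, ← mul_assoc]
  have r2 (X Y Z W : Loop n) : t (X * Y * loopEuler n W * Z) = t (loopEuler n W * Z * X * Y) := by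
    rw [mul_assoc, ht, ← mul_assoc]
  have r3 (X Y Z W : Loop n) : t (X * Y * Z * loopEuler n W) = t (loopEuler n W * X * Y * Z) := by
    rw [ht, ← mul_assoc, ← mul_assoc]
  simp only [jordan, map_smul, map_sub, map_add, loopEuler_mul, mul_add, add_mul, mul_sub,
    smul_mul_assoc, smul_eq_mul, ← mul_assoc, r1, r2, r3]
  ring

/-! ### The map `ρ` and triangular matrices -/

theorem rho_sub (X Y : Gl n) : rho (X - Y) = rho X - rho Y := by
  ext i j
  simp only [rho, Matrix.of_apply, Matrix.sub_apply]
  split_ifs <;> ring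

theorem rho_add (X Y : Gl n) : rho (X + Y) = rho X + rho Y := by
  ext i j
  simp only [rho, Matrix.of_apply, Matrix.add_apply]
  split_ifs <;> ring

theorem rho_smul (c : ℝ) (X : Gl n) : rho (c • X) = c • rho X := by
  ext i j
  simp only [rho, Matrix.of_apply, Matrix.smul_apply, smul_eq_mul]
  split_ifs <;> ring

theorem IsLower.rho_eq {X : Gl n} (hX : IsLower X) : rho X = -X := by
  ext i j
  simp only [rho, Matrix.of_apply, Matrix.neg_apply]
  split_ifs with h h'
  · rw [hX i j h.le, neg_zero]
  · rfl
  · rw [hX i j (not_lt.1 h'), neg_zero]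

theorem rho_transpose (X : Gl n) : rho X.transpose = -(rho X).transpose := by
  ext i j
  simp only [rho, Matrix.of_apply, Matrix.neg_apply, Matrix.transpose_apply]
  rcases lt_trichotomy i j with h | h | h
  · simp [h, h.not_gt]
  · subst h; simp
  · simp [h, h.not_gt]

theorem trace_rho_mul (X Y : Gl n) : Matrix.trace (rho X * Y) = -Matrix.trace (X * rho Y) := by
  simp only [Matrix.trace, Matrix.diag_apply, Matrix.mul_apply, ← Finset.sum_neg_distrib]
  refine Finset.sum_congr rfl fun i _ => Finset.sum_congr rfl fun k _ => ?_
  simp only [rho, Matrix.of_apply]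
  rcases lt_trichotomy i k with h | h | h
  · simp [h, h.not_gt]
  · subst h; simp
  · simp [h, h.not_gt]

theorem isLower_loopCoeff {k : ℕ} {X : Loop n} (hX : X ∈ supp n (Set.Iic (k * ((n : ℤ) - 1))))
    (hk : 0 < k) : IsLower (loopCoeff k X) := by
  intro i j hij
  refine hX i j k ?_
  have : (i : ℤ) ≤ j := by exact_mod_cast hij
  have : (0 : ℤ) < k := by exact_mod_cast hk
  simp only [deg, Set.mem_Iic, not_le]
  nlinarith

theorem loopCoeff_neg_of_symm {X : Loop n} (hX : involution X = X) (m : ℤ) :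
    loopCoeff (-m) X = (loopCoeff m X).transpose := by
  ext i j
  have := involution_coeff X i j (-m)
  rw [hX, neg_neg] at this
  exact this

theorem loopCoeff_neg_of_skew {X : Loop n} (hX : involution X = -X) (m : ℤ) :
    loopCoeff (-m) X = -(loopCoeff m X).transpose := by
  ext i j
  have := involution_coeff X i j (-m)
  rw [hX, neg_neg] at this
  simp only [Matrix.neg_apply, AddMonoidAlgebra.coeff_neg, Finsupp.neg_apply] at this
  simp only [loopCoeff, LinearMap.coe_mk, AddHom.coe_mk, Matrix.of_apply, Matrix.neg_apply,
    Matrix.transpose_apply]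
  linarith

theorem loopCoeff_signPart (m : ℤ) (X : Loop n) : loopCoeff m (signPart n X) =
    if 0 < m then loopCoeff m X else if m = 0 then rho (loopCoeff 0 X) else -loopCoeff m X := by
  ext i j
  have hi : (i : ℤ) < n := by exact_mod_cast i.2
  have hj : (j : ℤ) < n := by exact_mod_cast j.2
  have hi0 : (0 : ℤ) ≤ i := by positivity
  have hj0 : (0 : ℤ) ≤ j := by positivity
  simp only [loopCoeff, LinearMap.coe_mk, AddHom.coe_mk, Matrix.of_apply, signPart,
    LinearMap.sub_apply, Matrix.sub_apply, AddMonoidAlgebra.coeff_sub, Finsupp.sub_apply,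
    gradedPart_coeff, Set.mem_Ioi, Set.mem_Iio]
  rcases lt_trichotomy 0 m with h | h | h
  · have : 0 < deg i j m := by rw [deg]; nlinarith
    simp [h, this, this.not_gt]
  · subst h
    have h1 : 0 < deg i j 0 ↔ i < j := by simp [deg]
    have h2 : deg i j 0 < 0 ↔ j < i := by simp [deg]
    simp only [h1, h2, rho, Matrix.of_apply, lt_irrefl, if_false, if_true]
    rcases lt_trichotomy i j with h | h | h
    · simp [h, h.not_gt]
    · subst h; simp
    · simp [h, h.not_gt]
  · have : deg i j m < 0 := by rw [deg]; nlinarith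
    simp [h.not_gt, h.ne, this, this.not_gt]

/-! ### The Sklyanin bracket as a Lie derivative of the linear bracket -/

theorem trCoeff_mul_of_bounded {X : Loop n} (hX : Bounded 2 X) (Y : Loop n) (m : ℤ) :
    trCoeff m (X * Y) = Matrix.trace (loopCoeff (-2) X * loopCoeff (m + 2) Y)
      + Matrix.trace (loopCoeff (-1) X * loopCoeff (m + 1) Y)
      + Matrix.trace (loopCoeff 0 X * loopCoeff m Y)
      + Matrix.trace (loopCoeff 1 X * loopCoeff (m - 1) Y)
      + Matrix.trace (loopCoeff 2 X * loopCoeff (m - 2) Y) := by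
  rw [trCoeff_eq, loopCoeff_mul X Y _ hX, show Finset.Icc (-2 : ℤ) 2 = {-2, -1, 0, 1, 2} from rfl]
  simp [Matrix.trace_add, sub_neg_eq_add]
  ring

/-- On loops without powers of `λ` beyond `-2` and `2` this is minus the real part of the trace of
the value at the imaginary unit. -/
def traceForm (n : ℕ) : Loop n →ₗ[ℝ] ℝ := trCoeff 2 + trCoeff (-2) - trCoeff 0

theorem traceForm_mul_comm (X Y : Loop n) : traceForm n (X * Y) = traceForm n (Y * X) := by
  simp only [traceForm, LinearMap.sub_apply, LinearMap.add_apply, trCoeff_mul_comm _ X]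

/-- The contribution of the derivative of `ρ(L_A)` to the Lie derivative, compared with the
Sklyanin tensor. -/
theorem trace_rho_rePart {M K : Loop n} (hM : M ∈ supp n (Set.Iic (2 * ((n : ℤ) - 1))))
    (hK : K ∈ supp n (Set.Iic (2 * ((n : ℤ) - 1)))) (hMs : involution M = M)
    (hKs : involution K = -K) (bM : Bounded 2 M) (bK : Bounded 2 K) :
    Matrix.trace (rho (rePart (loopEvalI n K)) * rePart (loopEvalI n M)) =
      -trCoeff 0 (signPart n M * K)
        - (1 / 2) * traceForm n (loopEuler n M * K - M * loopEuler n K) := by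
  have lM : IsLower (loopCoeff 2 M) := isLower_loopCoeff (k := 2) (by exact_mod_cast hM) two_pos
  have lK : IsLower (loopCoeff 2 K) := isLower_loopCoeff (k := 2) (by exact_mod_cast hK) two_pos
  have nM := loopCoeff_neg_of_symm hMs 2
  have nK := loopCoeff_neg_of_skew hKs 2
  have bS : Bounded 2 (signPart n M) := by
    intro m hm
    rw [loopCoeff_signPart, bM m hm]
    split_ifs with h h'
    · rfl
    · subst h'
      exact absurd (by decide) hm
    · exact neg_zero
  rw [rePart_loopEvalI bM, rePart_loopEvalI bK]
  simp only [traceForm, LinearMap.sub_apply, LinearMap.add_apply, map_sub,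
    trCoeff_mul_of_bounded bM, trCoeff_mul_of_bounded bM.loopEuler, trCoeff_mul_of_bounded bS,
    loopCoeff_loopEuler, loopCoeff_signPart]
  have k3 : loopCoeff 3 K = 0 := bK _ (by decide)
  have k4 : loopCoeff 4 K = 0 := bK _ (by decide)
  have k3' : loopCoeff (-3) K = 0 := bK _ (by decide)
  have k4' : loopCoeff (-4) K = 0 := bK _ (by decide)
  norm_num [k3, k4, k3', k4']
  have e1 : rho (loopCoeff (-2) K) = loopCoeff (-2) K := by
    rw [nK, ← neg_one_smul ℝ, rho_smul, rho_transpose, lK.rho_eq]; simp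
  have e2 : rho (loopCoeff (-2) M) = loopCoeff (-2) M := by
    rw [nM, rho_transpose, lM.rho_eq]; simp
  have e3 : Matrix.trace (rho (loopCoeff 0 K) * loopCoeff 2 M) =
      Matrix.trace (loopCoeff 0 K * loopCoeff 2 M) := by
    rw [trace_rho_mul, lM.rho_eq]; simp
  have e4 : Matrix.trace (rho (loopCoeff 0 K) * loopCoeff (-2) M) =
      -Matrix.trace (loopCoeff 0 K * loopCoeff (-2) M) := by
    rw [trace_rho_mul, e2]
  have e5 := lK.trace_mul lM
  have e6 : Matrix.trace (loopCoeff (-2) K * loopCoeff (-2) M) = 0 := by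
    rw [nK, nM, neg_mul, Matrix.trace_neg, trace_mul_transpose_comm, e5, neg_zero]
  have e7 := trace_rho_mul (loopCoeff 0 K) (loopCoeff 0 M)
  have c (i j : ℤ) := Matrix.trace_mul_comm (loopCoeff i M) (loopCoeff j K)
  have c' := Matrix.trace_mul_comm (rho (loopCoeff 0 M)) (loopCoeff 0 K)
  simp only [rho_sub, lK.rho_eq, e1, mul_sub, sub_mul, neg_mul, Matrix.trace_sub, Matrix.trace_neg,
    e3, e4, e5, e6, c, c', e7]
  ring

/-- The contribution of the value of `ρ(L_A)` to the Lie derivative. Only the coefficients of `λ` and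
`λ⁻¹` of the loop of `L` survive the derivation `λ d/dλ`, and `ρ` maps their difference `L_A` to minus
their sum. -/
theorem trace_rho_imPart {L : Gl n} {Z : Loop n} (hZ : Z ∈ supp n (Set.Iic (3 * ((n : ℤ) - 1))))
    (hZs : involution Z = -Z) (bZ : Bounded 3 Z) :
    -Matrix.trace (rho (altPart L) * imPart (loopEvalI n Z)) =
      traceForm n (loopEuler n (toLoop L) * Z) := by
  have lZ : IsLower (loopCoeff 3 Z) := isLower_loopCoeff (k := 3) (by exact_mod_cast hZ) three_pos
  have nZ := loopCoeff_neg_of_skew hZs 3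
  have bL : Bounded 2 (toLoop L) := fun m hm =>
    bounded_toLoop L m (by simp only [Finset.mem_Icc] at *; omega)
  rw [imPart_loopEvalI bZ, altPart_eq_low, rho_sub, rho_transpose, (isLower_low L).rho_eq]
  simp only [traceForm, LinearMap.sub_apply, LinearMap.add_apply,
    trCoeff_mul_of_bounded bL.loopEuler, loopCoeff_loopEuler, loopCoeff_toLoop]
  have e1 := (isLower_low L).trace_mul lZ
  have e2 : Matrix.trace ((low L).transpose * loopCoeff (-3) Z) = 0 := by
    rw [nZ, mul_neg, Matrix.trace_neg, trace_mul_transpose_comm, e1, neg_zero]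
  norm_num
  simp only [mul_add, mul_sub, sub_mul, neg_mul, Matrix.trace_add, Matrix.trace_sub,
    Matrix.trace_neg, e1, e2]
  ring

theorem rho_altPart_transpose (V : Gl n) : (rho (altPart V)).transpose = rho (altPart V) := by
  have h := rho_transpose (altPart V)
  rw [altPart_transpose, ← neg_one_smul ℝ, rho_smul, neg_one_smul] at h
  exact (neg_inj.1 h).symm

theorem loopEvalI_jordan (L A : Gl n) :
    loopEvalI n (jordan (toLoop L) (toLoop A)) = jordan (herm L) (herm A) := by
  simp only [jordan, map_smul, map_add, map_mul]; rfl

theorem rePart_herm_of_symm {N : Gl n} (hN : N.transpose = N) :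
    rePart (herm N) = N ∧ imPart (herm N) = 0 := by
  rw [rePart_herm, imPart_herm, symPart, altPart, hN]
  constructor
  · module
  · simp

theorem glInner_odot_of_symm {N : Gl n} (hN : N.transpose = N) (L A : Gl n) :
    glInner (odot L N) A =
      Matrix.trace (N * rePart (loopEvalI n (jordan (toLoop L) (toLoop A)))) := by
  obtain ⟨h1, h2⟩ := rePart_herm_of_symm hN
  have h : reTrace n (jordan (herm L) (herm N) * herm A) =
      reTrace n (herm N * jordan (herm L) (herm A)) := by
    simp only [jordan, smul_mul_assoc, mul_smul_comm, map_smul, add_mul, mul_add, map_add]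
    rw [mul_assoc (herm L), reTrace_mul_comm (herm L), mul_assoc, mul_assoc, add_comm]
  rw [glInner_eq_reTrace, herm_odot, h, reTrace_apply, rePart_mul, h1, h2, zero_mul, sub_zero,
    loopEvalI_jordan]

theorem altPart_nsBracket (L A : Gl n) : altPart (nsBracket L A) =
    rePart (loopEvalI n (toLoop L * toLoop A - toLoop A * toLoop L)) := by
  rw [← imPart_herm, herm_nsBracket, imPart_I_smul, map_sub, map_mul, map_mul]; rfl

/-- The commutative product with a fixed matrix `R` fails to be a derivation of the linear bracket by
this term. -/
theorem glInner_odot_nsBracket (L A B R : Gl n) :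
    glInner (odot L R) (nsBracket A B) + glInner (odot (nsBracket L B) R) A
      - glInner (odot (nsBracket L A) R) B =
    reTrace n (Complex.I • (herm R * (herm A * herm L * herm B - herm B * herm L * herm A))) := by
  obtain ⟨t, ht⟩ : ∃ t : Matrix (Fin n) (Fin n) ℂ →ₗ[ℝ] ℝ, ∀ X, t X = reTrace n (Complex.I • X) :=
    ⟨{ toFun := fun X => reTrace n (Complex.I • X)
       map_add' := fun X Y => by rw [smul_add, map_add]
       map_smul' := fun c X => by rw [smul_comm, map_smul]; rfl }, fun X => rfl⟩
  have hc (X Y : Matrix (Fin n) (Fin n) ℂ) : t (X * Y) = t (Y * X) := by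
    rw [ht, ht, ← smul_mul_assoc, reTrace_mul_comm, mul_smul_comm]
  have hj (X Y : Matrix (Fin n) (Fin n) ℂ) : jordan (Complex.I • X) Y = Complex.I • jordan X Y := by
    simp only [jordan, smul_mul_assoc, mul_smul_comm, ← smul_add]
    rw [smul_comm]
  simp only [glInner_eq_reTrace, herm_odot, herm_nsBracket, hj, smul_mul_assoc, mul_smul_comm, ← ht]
  generalize herm L = l
  generalize herm A = a
  generalize herm B = b
  generalize herm R = r
  -- every word is rotated so that it begins with `r`
  have r1 (X Y Z : Matrix (Fin n) (Fin n) ℂ) : t (X * r * Y * Z) = t (r * Y * Z * X) := by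
    rw [mul_assoc, mul_assoc, hc, ← mul_assoc]
  have r2 (X Y Z : Matrix (Fin n) (Fin n) ℂ) : t (X * Y * r * Z) = t (r * Z * X * Y) := by
    rw [mul_assoc, hc, ← mul_assoc]
  simp only [jordan, map_smul, map_sub, map_add, mul_add, add_mul, mul_sub, sub_mul,
    smul_mul_assoc, smul_eq_mul, ← mul_assoc, r1, r2]
  ring

theorem odot_add_left (L L' M : Gl n) : odot (L + L') M = odot L M + odot L' M := by
  simp only [odot, jordan, symPart_add, altPart_add, mul_add, add_mul]; module

theorem odot_add_right (L M M' : Gl n) : odot L (M + M') = odot L M + odot L M' := by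
  simp only [odot, jordan, symPart_add, altPart_add, mul_add, add_mul]; module

theorem odot_smul_left (c : ℝ) (L M : Gl n) : odot (c • L) M = c • odot L M := by
  simp only [odot, jordan, symPart_smul, altPart_smul, mul_smul_comm, smul_mul_assoc]; module

theorem odot_smul_right (c : ℝ) (L M : Gl n) : odot L (c • M) = c • odot L M := by
  simp only [odot, jordan, symPart_smul, altPart_smul, mul_smul_comm, smul_mul_assoc]; module

/-- The derivative of the vector field `Y`. -/
def derivY (L W : Gl n) : Gl n := odot W (rho (altPart L)) + odot L (rho (altPart W))

theorem contDiff_fieldY : ContDiff ℝ ∞ (fieldY (n := n)) ∧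
    ∀ L W : Gl n, fderiv ℝ fieldY L W = derivY L W := by
  have h := contDiff_quadratic (0 : Gl n →ₗ[ℝ] Gl n)
    (LinearMap.mk₂ ℝ (fun L M : Gl n => odot L (rho (altPart M)))
      (fun L L' M => odot_add_left L L' _) (fun c L M => odot_smul_left c L _)
      (fun L M M' => by rw [altPart_add, rho_add, odot_add_right])
      (fun c L M => by rw [altPart_smul, rho_smul, odot_smul_right]))
  simp only [LinearMap.zero_apply, zero_add] at h
  exact h

theorem contDiff_fieldX : ContDiff ℝ ∞ (fieldX (n := n)) ∧
    ∀ L W : Gl n, fderiv ℝ fieldX L W = fieldX W := by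
  have h := contDiff_quadratic
    ({ toFun := fieldX
       map_add' := fun L M => by simp only [fieldX, altPart_add, rho_add]
       map_smul' := fun c L => by simp only [fieldX, altPart_smul, rho_smul, RingHom.id_apply] } :
      Gl n →ₗ[ℝ] Gl n) (0 : Gl n →ₗ[ℝ] Gl n →ₗ[ℝ] Gl n)
  simp only [LinearMap.zero_apply, add_zero] at h
  exact h

theorem lie_linBivector (X : Gl n → Gl n) (DX : Gl n → Gl n → Gl n) (L A B : Gl n) :
    (linBivector n).lie X DX L A B = glInner (X L) (nsBracket A B) +
      glInner (DX L (nsBracket L B)) A - glInner (DX L (nsBracket L A)) B := by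
  have h : (linBivector n).deriv L (X L) A B = glInner (X L) (nsBracket A B) := by
    simp [Bivector.deriv, linBivector]; rfl
  rw [Bivector.lie, h]; rfl

theorem glInner_add_left (X Y Z : Gl n) : glInner (X + Y) Z = glInner X Z + glInner Y Z := by
  simp only [glInner, add_mul, Matrix.trace_add]

theorem mul_mem_supp_Iic {k l d : ℤ} (h : k + l = d) {X Y : Loop n}
    (hX : X ∈ supp n (Set.Iic (k * ((n : ℤ) - 1))))
    (hY : Y ∈ supp n (Set.Iic (l * ((n : ℤ) - 1)))) :
    X * Y ∈ supp n (Set.Iic (d * ((n : ℤ) - 1))) := by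
  refine mul_mem_supp ?_ hX hY
  intro x hx y hy
  subst h
  simp only [Set.mem_Iic] at *
  linarith

theorem toLoop_mem_supp (L : Gl n) : toLoop L ∈ supp n (Set.Iic (1 * ((n : ℤ) - 1))) := by
  rw [one_mul]
  exact (mem_phaseSpace.1 (toLoop_mem L)).2

theorem involution_toLoop (L : Gl n) : involution (toLoop L) = toLoop L :=
  (mem_phaseSpace.1 (toLoop_mem L)).1

theorem involution_commutator (L A : Gl n) :
    involution (toLoop L * toLoop A - toLoop A * toLoop L) =
      -(toLoop L * toLoop A - toLoop A * toLoop L) := by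
  rw [map_sub, involution_mul, involution_mul, involution_toLoop, involution_toLoop, neg_sub]

/-- The terms of the Lie derivative along `Y` in which `ρ` is differentiated. -/
theorem glInner_odot_rho_altPart (L A B : Gl n) :
    glInner (odot L (rho (altPart (nsBracket L B)))) A =
      -trCoeff 0 (signPart n (jordan (toLoop L) (toLoop A)) *
        (toLoop L * toLoop B - toLoop B * toLoop L))
      - (1 / 2) * traceForm n (loopEuler n (jordan (toLoop L) (toLoop A)) *
          (toLoop L * toLoop B - toLoop B * toLoop L) - jordan (toLoop L) (toLoop A) *
            loopEuler n (toLoop L * toLoop B - toLoop B * toLoop L)) := by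
  have hs (X Y : Gl n) :
      toLoop X * toLoop Y ∈ supp n (Set.Iic (2 * ((n : ℤ) - 1))) :=
    mul_mem_supp_Iic one_add_one_eq_two (toLoop_mem_supp X) (toLoop_mem_supp Y)
  have bs (X Y : Gl n) : Bounded 2 (toLoop X * toLoop Y) :=
    (bounded_toLoop X).mul one_add_one_eq_two (bounded_toLoop Y)
  have m1 : jordan (toLoop L) (toLoop A) ∈ supp n (Set.Iic (2 * ((n : ℤ) - 1))) :=
    Submodule.smul_mem _ _ (add_mem (hs L A) (hs A L))
  have m2 : involution (jordan (toLoop L) (toLoop A)) = jordan (toLoop L) (toLoop A) := by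
    rw [involution_jordan, involution_toLoop, involution_toLoop]
  have m3 : Bounded 2 (jordan (toLoop L) (toLoop A)) :=
    (bounded_toLoop L).jordan one_add_one_eq_two (bounded_toLoop A)
  rw [glInner_odot_of_symm (rho_altPart_transpose _), altPart_nsBracket]
  exact trace_rho_rePart m1 (sub_mem (hs L B) (hs B L)) m2 (involution_commutator L B) m3
    ((bs L B).sub (bs B L))

/-- The terms of the Lie derivative along `Y` in which `ρ` is not differentiated. -/
theorem glInner_odot_rho_nsBracket (L A B : Gl n) :
    glInner (odot L (rho (altPart L))) (nsBracket A B)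
      + glInner (odot (nsBracket L B) (rho (altPart L))) A
      - glInner (odot (nsBracket L A) (rho (altPart L))) B =
    traceForm n (loopEuler n (toLoop L) *
      (toLoop A * toLoop L * toLoop B - toLoop B * toLoop L * toLoop A)) := by
  have hs (X Y Z : Gl n) :
      toLoop X * toLoop Y * toLoop Z ∈ supp n (Set.Iic (3 * ((n : ℤ) - 1))) :=
    mul_mem_supp_Iic two_add_one_eq_three (mul_mem_supp_Iic one_add_one_eq_two (toLoop_mem_supp X) (toLoop_mem_supp Y))
      (toLoop_mem_supp Z)
  have bs (X Y Z : Gl n) : Bounded 3 (toLoop X * toLoop Y * toLoop Z) :=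
    ((bounded_toLoop X).mul one_add_one_eq_two (bounded_toLoop Y)).mul two_add_one_eq_three
      (bounded_toLoop Z)
  have hi : involution (toLoop A * toLoop L * toLoop B - toLoop B * toLoop L * toLoop A) =
      -(toLoop A * toLoop L * toLoop B - toLoop B * toLoop L * toLoop A) := by
    simp only [map_sub, involution_mul, involution_toLoop, mul_assoc, neg_sub]
  have hh : herm A * herm L * herm B - herm B * herm L * herm A =
      loopEvalI n (toLoop A * toLoop L * toLoop B - toLoop B * toLoop L * toLoop A) := by
    simp only [map_sub, map_mul]; rfl
  obtain ⟨h1, h2⟩ := rePart_herm_of_symm (rho_altPart_transpose L)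
  rw [glInner_odot_nsBracket, reTrace_apply, rePart_I_smul, imPart_mul, h1, h2, zero_mul, add_zero,
    Matrix.trace_neg, hh]
  exact trace_rho_imPart (sub_mem (hs A L B) (hs B L A)) hi ((bs A L B).sub (bs B L A))

/-- The Sklyanin tensor is the Lie derivative of the linear tensor along `Y`. -/
theorem lie_fieldY (L A B : Gl n) :
    (linBivector n).lie fieldY derivY L A B = loopSkl (toLoop L) (toLoop A) (toLoop B) := by
  have h1 := glInner_odot_rho_nsBracket L A B
  rw [trace_loopEuler_identity _ traceForm_mul_comm] at h1
  have h2 := glInner_odot_rho_altPart L A B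
  have h3 := glInner_odot_rho_altPart L B A
  rw [loopSkl_eq_sklPolar (toLoop_mem_symmElts L) (toLoop_mem_symmElts A) (toLoop_mem_symmElts B),
    sklPolar_eq_jordan, ← neg_sub (toLoop L * toLoop A), ← neg_sub (toLoop L * toLoop B), mul_neg,
    mul_neg, map_neg, map_neg, lie_linBivector, derivY, derivY, glInner_add_left, glInner_add_left,
    fieldY]
  linarith

/-- The Semenov-Tian-Shansky tensor is the Lie derivative of the linear tensor along `X`. -/
theorem lie_fieldX (L A B : Gl n) : (linBivector n).lie fieldX (fun _ W => fieldX W) L A B =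
    loopSem (toLoop L) (toLoop A) (toLoop B) := by
  have hs : symPart (1 : Gl n) = 1 := by
    rw [symPart, Matrix.transpose_one]; module
  have ha : altPart (1 : Gl n) = 0 := by
    rw [altPart, Matrix.transpose_one, sub_self, smul_zero]
  have h1 (M : Gl n) : odot 1 M = symPart M + altPart M := by
    simp only [odot, jordan, hs, ha, one_mul, mul_one, zero_mul, mul_zero]
    module
  have ho (M : Gl n) : odot (L + 1) M = odot L M + M := by
    rw [odot_add_left, h1, symPart_add_altPart]
  have hn (M : Gl n) : nsBracket (L + 1) M = nsBracket L M := by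
    simp only [nsBracket, symPart_add, altPart_add, hs, ha, Ring.lie_def, add_mul, mul_add, one_mul,
      mul_one, add_zero]
    abel
  have hal : altPart (L + 1) = altPart L := by rw [altPart_add, ha, add_zero]
  rw [loopSem_eq, ← toLoop_one, ← toLoop_add, ← lie_fieldY, ← lie_fieldY]
  simp only [lie_linBivector, hn, derivY, fieldX, fieldY, ho, hal, glInner_add_left]
  ring

theorem sklBracket_eq_lieDeriv {f g : Gl n → ℝ} (hf : Smooth f) (hg : Smooth g) :
    sklBracket n f g = lieDeriv fieldY (linBracket n) f g := by
  ext L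
  rw [linBracket_eq, (linBivector n).lieDeriv_bracket contDiff_fieldY.1 contDiff_fieldY.2 hf hg,
    lie_fieldY]
  rfl

theorem semBracket_eq_lieDeriv_fieldX {f g : Gl n → ℝ} (hf : Smooth f) (hg : Smooth g) :
    semBracket n f g = lieDeriv fieldX (linBracket n) f g := by
  ext L
  rw [linBracket_eq, (linBivector n).lieDeriv_bracket contDiff_fieldX.1
    (DX := fun _ W => fieldX W) contDiff_fieldX.2 hf hg, lie_fieldX]
  rfl

theorem isTrihamiltonian : IsTrihamiltonian (semBracket n) (linBracket n) (sklBracket n) :=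
  ⟨isPoisson_sem.compatible isPoisson_lin
      (mixed_of_lieDeriv contDiff_fieldX.1 isPoisson_lin (fun _ _ => isPoisson_sem.smooth _ _)
        fun _ _ => semBracket_eq_lieDeriv_fieldX).symm,
    isPoisson_sem.compatible isPoisson_skl mixed_skl_sem.symm,
    isPoisson_lin.compatible isPoisson_skl
      (mixed_of_lieDeriv contDiff_fieldY.1 isPoisson_lin (fun _ _ => isPoisson_skl.smooth _ _)
        fun _ _ => sklBracket_eq_lieDeriv)⟩

end Kupershmidt

end

open Kupershmidt in
theorem mainTheorem1 (n : ℕ) :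
    -- the Semenov-Tian-Shansky and Sklyanin brackets of the loop algebra reduce to `gl(n)`
    IsReduction loopSem (semBracket n) ∧ IsReduction loopSkl (sklBracket n) ∧
    -- the three brackets are mutually compatible Poisson brackets
    IsTrihamiltonian (semBracket n) (linBracket n) (sklBracket n) ∧
    -- two of them are Lie derivatives of the third
    (∀ f g : Gl n → ℝ, Smooth f → Smooth g →
      semBracket n f g = lieDeriv fieldX (linBracket n) f g) ∧
    (∀ f g : Gl n → ℝ, Smooth f → Smooth g →
      sklBracket n f g = lieDeriv fieldY (linBracket n) f g) :=
  ⟨isReduction_sem, isReduction_skl, isTrihamiltonian, fun _ _ => semBracket_eq_lieDeriv_fieldX,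
    fun _ _ => sklBracket_eq_lieDeriv⟩
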